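/- All graphs are finite, simple and undirected. For a graph $G=(V,E)$ with boundary $\delta\Omega\subseteq V$, the Steklov eigenvalues of $(G,\delta\Omega)$ are the real numbers $\lambda$ for which there is a nonzero $f:V\to\mathbb R$ with $\sum_{y\sim x}(f(x)-f(y))=0$ for $x\in V\setminus\delta\Omega$ and $\sum_{y\sim x}(f(x)-f(y))=\lambda f(x)$ for $x\in\delta\Omega$. Listed in increasing order with multiplicity they are $0=\lambda_1(G,\delta\Omega)\le\lambda_2(G,\delta\Omega)\le\dots\le\lambda_{|\delta\Omega|}(G,\delta\Omega)$ when $G$ is connected. A graph $G$ is fully triangulated if it is the graph of a triangulation of a closed connected orientable surface (of any genus): each face is a triangle given by its three vertices, each edge lies in exactly two faces, and the triangles at each vertex form a single cycle around it. The hexagon-subdivision of such a $G$ adds one new vertex (midpoint) for each edge and replaces each face $abc$ by the four triangles $\{a,m_{ab},m_{ac}\}$, $\{b,m_{ab},m_{bc}\}$, $\{c,m_{ac},m_{bc}\}$, $\{m_{ab},m_{bc},m_{ac}\}$, where $m_{xy}$ is the midpoint of the edge $xy$. Let $G^{(k)}$ be the graph obtained from $G$ by $k$ successive hexagon-subdivisions.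 **Lemma.** For every $D$ there are constants $c,C>0$, depending only on $D$, such that the following holds. Let $G$ be a fully triangulated graph of maximum degree at most $D$, with a boundary $\delta\Omega$ such that $|\delta\Omega|\ge 2$, and let $k\ge 0$. Then there is a boundary set $\delta\Omega^{(k)}$ of $G^{(k)}$ with $|\delta\Omega^{(k)}|\ge 2$ and $$c\,4^k|\delta\Omega|\le|\delta\Omega^{(k)}|\le C\,4^k|\delta\Omega|$$ such that $$|\delta\Omega|\,\lambda_2(G,\delta\Omega)\le C\,|\delta\Omega^{(k)}|\,\lambda_2\bigl(G^{(k)},\delta\Omega^{(k)}\bigr).$$ -/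

import Mathlib

universe u

/-! ### The Steklov problem on a finite graph with boundary -/

section Steklov

variable {V : Type u} [Fintype V]

open Classical in
/-- The graph Laplacian `(Δ f)(x) = ∑_{y ~ x} (f x - f y)`. At a boundary vertex the same sum is
the outward normal derivative of `f`. -/
noncomputable def graphLaplacian (G : SimpleGraph V) (f : V → ℝ) (x : V) : ℝ :=
  ∑ y ∈ G.neighborFinset x, (f x - f y)

/-- The solutions `f` of the Steklov problem on `(G, B)` with parameter `μ`:
`Δ f = 0` off the boundary `B`, and `∂_ν f = μ f` on `B`. The real number `μ` is a Steklov
eigenvalue exactly when this space is nonzero. -/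
noncomputable def steklovEigenspace (G : SimpleGraph V) (B : Finset V) (μ : ℝ) :
    Submodule ℝ (V → ℝ) where
  carrier := {f | (∀ x, x ∉ B → graphLaplacian G f x = 0) ∧
    ∀ x, x ∈ B → graphLaplacian G f x = μ * f x}
  zero_mem' := by simp [graphLaplacian]
  add_mem' := by
    rintro f g ⟨hf, hf'⟩ ⟨hg, hg'⟩
    have key : ∀ x, graphLaplacian G (f + g) x = graphLaplacian G f x + graphLaplacian G g x := by
      intro x
      simp only [graphLaplacian, ← Finset.sum_add_distrib, Pi.add_apply]
      exact Finset.sum_congr rfl fun y _ => by ring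
    refine ⟨fun x hx => ?_, fun x hx => ?_⟩
    · rw [key, hf x hx, hg x hx, add_zero]
    · rw [key, hf' x hx, hg' x hx, Pi.add_apply]; ring
  smul_mem' := by
    rintro c f ⟨hf, hf'⟩
    have key : ∀ x, graphLaplacian G (c • f) x = c * graphLaplacian G f x := by
      intro x
      simp only [graphLaplacian, Finset.mul_sum, Pi.smul_apply, smul_eq_mul]
      exact Finset.sum_congr rfl fun y _ => by ring
    refine ⟨fun x hx => ?_, fun x hx => ?_⟩
    · rw [key, hf x hx, mul_zero]
    · rw [key, hf' x hx, Pi.smul_apply, smul_eq_mul]; ring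

/-- `λ_k(G, B)`, `1 ≤ k ≤ |B|`: the `k`-th smallest Steklov eigenvalue, counted with multiplicity,
i.e. the least `t` such that the eigenfunctions with eigenvalue at most `t` span a space of
dimension at least `k`. -/
noncomputable def steklovEigenvalue (G : SimpleGraph V) (B : Finset V) (k : ℕ) : ℝ :=
  sInf {t : ℝ | k ≤ Module.finrank ℝ
    (⨆ (μ : ℝ) (_ : μ ≤ t), steklovEigenspace G B μ : Submodule ℝ (V → ℝ))}

end Steklov

/-! ### Fully triangulated graphs and hexagon-subdivision -/

/-- A finite vertex set together with a family of faces, each given by its set of vertices. -/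
structure TriangleComplex where
  /-- The vertices. -/
  Vert : Type u
  /-- There are finitely many of them. -/
  [fintypeVert : Fintype Vert]
  /-- The faces. -/
  faces : Set (Set Vert)

namespace TriangleComplex

attribute [instance] TriangleComplex.fintypeVert

/-- The underlying graph: two distinct vertices are adjacent iff they lie in a common face. -/
def graph (K : TriangleComplex.{u}) : SimpleGraph K.Vert where
  Adj x y := x ≠ y ∧ ∃ t ∈ K.faces, x ∈ t ∧ y ∈ t
  symm := ⟨fun _ _ h => ⟨h.1.symm, h.2.imp fun _ ht => ⟨ht.1, ht.2.2, ht.2.1⟩⟩⟩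
  loopless := ⟨fun _ h => h.1 rfl⟩

/-- The link of a vertex `v`: the graph on the neighbours of `v` whose edges are the sides opposite
to `v` of the triangles at `v`. -/
def link (K : TriangleComplex.{u}) (v : K.Vert) :
    SimpleGraph {w : K.Vert // K.graph.Adj v w} where
  Adj w x := w ≠ x ∧ ({v, w.1, x.1} : Set K.Vert) ∈ K.faces
  symm := ⟨fun w x h => ⟨h.1.symm, by rw [Set.pair_comm]; exact h.2⟩⟩
  loopless := ⟨fun _ h => h.1 rfl⟩

/-- An orientation: `o a b c` says that the face `{a, b, c}` is traversed in the cyclic order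
`a → b → c → a`. Every face gets exactly one of its two cyclic orders, and a directed edge is
traversed by at most one face, so the two faces at an edge traverse it in opposite directions. -/
structure IsOrientation (K : TriangleComplex.{u}) (o : K.Vert → K.Vert → K.Vert → Prop) :
    Prop where
  face : ∀ a b c, o a b c → ({a, b, c} : Set K.Vert) ∈ K.faces
  rotate : ∀ a b c, o a b c → o b c a
  xor_reverse : ∀ a b c, ({a, b, c} : Set K.Vert) ∈ K.faces → Xor (o a b c) (o b a c)
  coherent : ∀ a b c d, o a b c → o a b d → c = d

/-- The faces form a triangulation of a closed connected orientable surface (of any genus), so that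
`K.graph` is a fully triangulated graph: faces are triangles, every edge lies in exactly two faces,
the link of every vertex is connected (hence, being finite and 2-regular, a cycle), the graph is
connected, and the faces can be oriented coherently. -/
structure IsFullTriangulation (K : TriangleComplex.{u}) : Prop where
  triangle : ∀ t ∈ K.faces, t.ncard = 3
  two_faces : ∀ x y, K.graph.Adj x y → {t | t ∈ K.faces ∧ x ∈ t ∧ y ∈ t}.ncard = 2
  link_connected : ∀ v, (K.link v).Connected
  connected : K.graph.Connected
  orientable : ∃ o, K.IsOrientation o

open Classical in
/-- The hexagon-subdivision: the vertices are the old vertices and one new vertex (the midpoint) for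
each edge, and each face `{a, b, c}` is replaced by three corner triangles `{a, ab, ac}`,
`{b, ab, bc}`, `{c, ac, bc}` and the central triangle `{ab, bc, ac}`. -/
noncomputable def hexSubdivision (K : TriangleComplex.{u}) : TriangleComplex.{u} where
  Vert := K.Vert ⊕ K.graph.edgeSet
  faces := {t | ∃ (a b c : K.Vert) (hab : K.graph.Adj a b) (hbc : K.graph.Adj b c)
    (hac : K.graph.Adj a c), ({a, b, c} : Set K.Vert) ∈ K.faces ∧
      (t = {Sum.inl a, Sum.inr ⟨s(a, b), hab⟩, Sum.inr ⟨s(a, c), hac⟩} ∨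
       t = {Sum.inr ⟨s(a, b), hab⟩, Sum.inr ⟨s(b, c), hbc⟩, Sum.inr ⟨s(a, c), hac⟩})}

/-- The complex obtained by `k` successive hexagon-subdivisions; its graph is `G^(k)`. -/
noncomputable def refine (K : TriangleComplex.{u}) (k : ℕ) : TriangleComplex.{u} :=
  hexSubdivision^[k] K

end TriangleComplex

/-!
Write `G_k` for the `k`-th subdivision of `G`. The boundary of `G_k` is obtained by choosing one
triangle at every vertex of `B`, dividing it into its `4 ^ k` small triangles, and taking one vertex
of each of these. By bounded degree it has about `4 ^ k |B|` elements.

Let `f` be a second Steklov eigenfunction on `G_k`. It is transplanted to `G` by choosing an edge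
`v (n v)` at every vertex `v` and setting `g v` to be the average of `f` over this edge, subdivided
`k` times. Two facts about a single triangle of `G`, with constants independent of `k`, carry the
argument:

* the averages of `f` over two sides of the triangle differ by at most the square root of the energy
  of `f` in the triangle (`sq_edgeAverage_sub_le`);
* the sum over the small triangles of the squared deviation of `f` from such an average is at most
  `16 * 4 ^ k` times this energy (`descendantSum_sq_sub_edgeAverage_le`).

Both go by induction on `k`, from the four triangles of the first subdivision to the one they
divide. In the first, the difference of the averages is half a sum of four such differences, and
`((w + x + y + z) / 2) ^ 2 ≤ w ^ 2 + x ^ 2 + y ^ 2 + z ^ 2` reproduces the same bound, as energy is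
additive. In the second, normalising by `4 ^ k` makes the induction step a contraction. This is the
discrete form of the scale invariance of the Dirichlet energy in dimension two.

Going around the link of a vertex, the first fact bounds the energy of `g` by a multiple of that of
`f` (`dirichletForm_edgeAverage_le`); here one uses that distinct triangles of `G` have distinct
descendants (`child_inj`) and that subdivision preserves bounded geometry
(`HasBoundedGeometry.refine`). The second fact bounds the norm of `f` on its boundary by `4 ^ k`
times the variance of `g` on `B` plus the energy of `f`, where the energy term is harmless because
`λ₂(G, B)` is bounded by twice the degree. The variational characterisation of `λ₂`
(`steklovEigenvalue_two_eq`) then gives `λ₂(G, B) ≤ C 4 ^ k λ₂(G_k, B_k)`.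
-/

/-! ### The variational characterisation of the second Steklov eigenvalue -/

section Variational

variable {V : Type u} [Fintype V]

open Classical in
/-- The Dirichlet form `∑_{x, y : x ~ y} (f x - f y) (g x - g y)` over ordered pairs, so that every
edge is counted twice. -/
noncomputable def dirichletForm (G : SimpleGraph V) (f g : V → ℝ) : ℝ :=
  ∑ x, ∑ y, if G.Adj x y then (f x - f y) * (g x - g y) else 0

open Classical in
theorem graphLaplacian_eq_sum (G : SimpleGraph V) (f : V → ℝ) (x : V) :
    graphLaplacian G f x = ∑ y, if G.Adj x y then f x - f y else 0 := by
  rw [graphLaplacian, ← Finset.sum_filter]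
  refine Finset.sum_congr ?_ fun _ _ => rfl
  ext y
  simp

theorem dirichletForm_add_right (G : SimpleGraph V) (f g h : V → ℝ) :
    dirichletForm G f (g + h) = dirichletForm G f g + dirichletForm G f h := by
  simp only [dirichletForm, ← Finset.sum_add_distrib, Pi.add_apply]
  refine Finset.sum_congr rfl fun x _ => Finset.sum_congr rfl fun y _ => ?_
  split_ifs <;> ring

theorem dirichletForm_smul_right (G : SimpleGraph V) (c : ℝ) (f g : V → ℝ) :
    dirichletForm G f (c • g) = c * dirichletForm G f g := by
  simp only [dirichletForm, Finset.mul_sum, Pi.smul_apply, smul_eq_mul]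
  refine Finset.sum_congr rfl fun x _ => Finset.sum_congr rfl fun y _ => ?_
  split_ifs <;> ring

theorem dirichletForm_comm (G : SimpleGraph V) (f g : V → ℝ) :
    dirichletForm G f g = dirichletForm G g f := by
  simp only [dirichletForm, mul_comm]

theorem dirichletForm_const_right (G : SimpleGraph V) (f : V → ℝ) (c : ℝ) :
    dirichletForm G f (fun _ => c) = 0 := by
  simp [dirichletForm]

theorem dirichletForm_sub_const (G : SimpleGraph V) (f : V → ℝ) (c : ℝ) :
    dirichletForm G (fun x => f x - c) (fun x => f x - c) = dirichletForm G f f := by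
  simp [dirichletForm]

theorem dirichletForm_self_nonneg (G : SimpleGraph V) (f : V → ℝ) : 0 ≤ dirichletForm G f f := by
  refine Finset.sum_nonneg fun x _ => Finset.sum_nonneg fun y _ => ?_
  split_ifs
  · exact mul_self_nonneg _
  · rfl

/-- Green's formula. -/
theorem dirichletForm_eq_sum_graphLaplacian (G : SimpleGraph V) (f g : V → ℝ) :
    dirichletForm G f g = 2 * ∑ x, graphLaplacian G f x * g x := by
  classical
  have h1 : dirichletForm G f g =
      (∑ x, ∑ y, (if G.Adj x y then f x - f y else 0) * g x) -
        ∑ x, ∑ y, (if G.Adj x y then f x - f y else 0) * g y := by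
    simp only [dirichletForm, ← Finset.sum_sub_distrib]
    refine Finset.sum_congr rfl fun x _ => Finset.sum_congr rfl fun y _ => ?_
    split_ifs <;> ring
  have h2 : ∑ x, ∑ y, (if G.Adj x y then f x - f y else 0) * g y =
      -∑ x, ∑ y, (if G.Adj x y then f x - f y else 0) * g x := by
    rw [Finset.sum_comm, ← Finset.sum_neg_distrib]
    refine Finset.sum_congr rfl fun x _ => ?_
    rw [← Finset.sum_neg_distrib]
    refine Finset.sum_congr rfl fun y _ => ?_
    simp only [G.adj_comm y x]
    split_ifs <;> ring
  rw [h1, h2]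
  simp only [graphLaplacian_eq_sum, Finset.sum_mul]
  ring

theorem sq_sub_le_dirichletForm (G : SimpleGraph V) (f : V → ℝ) {x y : V} (h : G.Adj x y) :
    (f x - f y) ^ 2 ≤ dirichletForm G f f := by
  classical
  have hn : ∀ x y, 0 ≤ (if G.Adj x y then (f x - f y) * (f x - f y) else 0) := by
    intro x y
    split_ifs
    · exact mul_self_nonneg _
    · rfl
  calc (f x - f y) ^ 2 = if G.Adj x y then (f x - f y) * (f x - f y) else 0 := by
        rw [if_pos h, sq]
    _ ≤ ∑ y, if G.Adj x y then (f x - f y) * (f x - f y) else 0 :=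
        Finset.single_le_sum (f := fun y => if G.Adj x y then (f x - f y) * (f x - f y) else 0)
          (fun y _ => hn x y) (Finset.mem_univ y)
    _ ≤ dirichletForm G f f :=
        Finset.single_le_sum
          (f := fun x => ∑ y, if G.Adj x y then (f x - f y) * (f x - f y) else 0)
          (fun x _ => Finset.sum_nonneg fun y _ => hn x y) (Finset.mem_univ x)

/-- On a connected graph, a function that varies by at most `s` along each edge varies by at most
`s` times the number of vertices overall. -/
theorem abs_sub_le_card_mul_of_connected {W : Type*} [Fintype W] {G : SimpleGraph W}
    (hG : G.Connected) {F : W → ℝ} {s : ℝ} (hs : 0 ≤ s) (h : ∀ x y, G.Adj x y → |F x - F y| ≤ s)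
    (x y : W) : |F x - F y| ≤ Fintype.card W * s := by
  classical
  have hwalk : ∀ {x y : W} (p : G.Walk x y), |F x - F y| ≤ p.length * s := by
    intro x y p
    induction p with
    | nil => simp
    | @cons a b c hab p ih =>
      have := abs_sub_le (F a) (F b) (F c)
      have := h a b hab
      rw [SimpleGraph.Walk.length_cons]
      push_cast
      linarith
  obtain ⟨p⟩ := hG.preconnected x y
  refine (hwalk p.toPath.1).trans ?_
  gcongr
  exact p.toPath.2.length_lt.le

theorem eq_of_dirichletForm_self_eq_zero {G : SimpleGraph V} (hG : G.Connected) {f : V → ℝ}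
    (h : dirichletForm G f f = 0) (x y : V) : f x = f y := by
  have key := abs_sub_le_card_mul_of_connected (F := f) hG le_rfl
    (fun x y hxy => by
      have h1 := sq_sub_le_dirichletForm G f hxy
      rw [h] at h1
      exact (abs_eq_zero.2 (pow_eq_zero_iff two_ne_zero |>.1 (le_antisymm h1 (sq_nonneg _)))).le)
    x y
  rw [mul_zero] at key
  exact sub_eq_zero.1 (abs_eq_zero.1 (le_antisymm key (abs_nonneg _)))

theorem continuous_dirichletForm_self (G : SimpleGraph V) :
    Continuous fun f : V → ℝ => dirichletForm G f f := by
  unfold dirichletForm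
  refine continuous_finsetSum _ fun x _ => continuous_finsetSum _ fun y _ => ?_
  split_ifs
  · fun_prop
  · exact continuous_const

/-- A function on `V` that is `1` at one boundary point, `-1` at another one, and `0` elsewhere is
an admissible competitor for the second Steklov eigenvalue. -/
theorem exists_sum_eq_zero_sum_sq_eq_two {B : Finset V} (hB : 2 ≤ B.card) :
    ∃ f : V → ℝ, ∑ x ∈ B, f x = 0 ∧ ∑ x ∈ B, f x ^ 2 = 2 ∧ ∑ x, f x ^ 2 = 2 := by
  classical
  obtain ⟨v, hv, w, hw, hvw⟩ := Finset.one_lt_card.1 hB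
  have hsq : ∀ x, ((if x = v then (1 : ℝ) else 0) - if x = w then 1 else 0) ^ 2 =
      (if x = v then 1 else 0) + if x = w then 1 else 0 := by
    intro x
    by_cases h1 : x = v
    · have h2 : x ≠ w := fun h => hvw (h1 ▸ h)
      simp [h1, hvw]
    · simp [h1]
  refine ⟨fun x => (if x = v then 1 else 0) - if x = w then 1 else 0, ?_, ?_, ?_⟩
  · simp [Finset.sum_sub_distrib, hv, hw]
  · simp only [hsq, Finset.sum_add_distrib]
    simp [hv, hw]
    norm_num
  · simp only [hsq, Finset.sum_add_distrib]
    simp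
    norm_num

/-- The Rayleigh quotient attains its minimum over the functions of mean zero on the boundary. -/
theorem exists_forall_mul_le_dirichletForm {G : SimpleGraph V} (hG : G.Connected) {B : Finset V}
    (hB : 2 ≤ B.card) :
    ∃ f : V → ℝ, ∑ x ∈ B, f x = 0 ∧ ∑ x ∈ B, f x ^ 2 = 1 ∧
      ∀ g : V → ℝ, ∑ x ∈ B, g x = 0 →
        dirichletForm G f f * ∑ x ∈ B, g x ^ 2 ≤ dirichletForm G g g := by
  obtain ⟨f₀, hf₀, hf₀', -⟩ := exists_sum_eq_zero_sum_sq_eq_two hB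
  -- By homogeneity it suffices to minimise the energy over functions of norm one on `B`.
  have hscale : ∀ g : V → ℝ, ∑ x ∈ B, g x = 0 → 0 < ∑ x ∈ B, g x ^ 2 →
      ∃ c : ℝ, ∑ x ∈ B, (c • g) x = 0 ∧ ∑ x ∈ B, (c • g) x ^ 2 = 1 ∧
        c ^ 2 * ∑ x ∈ B, g x ^ 2 = 1 := by
    intro g hg hpos
    have h1 : (√(∑ x ∈ B, g x ^ 2))⁻¹ ^ 2 * ∑ x ∈ B, g x ^ 2 = 1 := by
      rw [inv_pow, Real.sq_sqrt hpos.le, inv_mul_cancel₀ hpos.ne']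
    refine ⟨(√(∑ x ∈ B, g x ^ 2))⁻¹, ?_, ?_, h1⟩
    · simp only [Pi.smul_apply, smul_eq_mul, ← Finset.mul_sum, hg, mul_zero]
    · simp only [Pi.smul_apply, smul_eq_mul, mul_pow, ← Finset.mul_sum]
      exact h1
  obtain ⟨c₀, hc₀, hc₀', -⟩ := hscale f₀ hf₀ (by rw [hf₀']; norm_num)
  set R := dirichletForm G (c₀ • f₀) (c₀ • f₀) with hR
  let S : Set (V → ℝ) := {f | ∑ x ∈ B, f x = 0 ∧ ∑ x ∈ B, f x ^ 2 = 1 ∧ dirichletForm G f f ≤ R}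
  have hclosed : IsClosed S := by
    refine IsClosed.inter (isClosed_eq (by fun_prop) continuous_const) (IsClosed.inter
      (isClosed_eq (by fun_prop) continuous_const)
      (isClosed_le (continuous_dirichletForm_self G) continuous_const))
  -- On the boundary `f` is at most `1`, and the bound on the energy limits its variation elsewhere.
  have hbdd : Bornology.IsBounded S := by
    refine (Metric.isBounded_iff_subset_closedBall 0).2
      ⟨1 + Fintype.card V * √R, fun f hf => ?_⟩
    obtain ⟨-, hf2, hf3⟩ := hf
    rw [mem_closedBall_zero_iff, pi_norm_le_iff_of_nonneg (by positivity)]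
    intro x
    obtain ⟨b, hb⟩ : B.Nonempty := Finset.card_pos.1 (by omega)
    have h1 : |f b| ≤ 1 := by
      rw [← sq_le_one_iff_abs_le_one, ← hf2]
      exact Finset.single_le_sum (f := fun x => f x ^ 2) (fun x _ => sq_nonneg _) hb
    have h2 := abs_sub_le_card_mul_of_connected (F := f) hG (Real.sqrt_nonneg R)
      (fun x y hxy => Real.abs_le_sqrt ((sq_sub_le_dirichletForm G f hxy).trans hf3)) x b
    have h3 := abs_sub_abs_le_abs_sub (f x) (f b)
    rw [Real.norm_eq_abs]
    linarith
  obtain ⟨f, ⟨hf1, hf2, hf3⟩, hmin⟩ := (Metric.isCompact_of_isClosed_isBounded hclosed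
    hbdd).exists_isMinOn ⟨c₀ • f₀, hc₀, hc₀', le_rfl⟩ (continuous_dirichletForm_self G).continuousOn
  refine ⟨f, hf1, hf2, fun g hg => ?_⟩
  rcases (Finset.sum_nonneg fun x (_ : x ∈ B) => sq_nonneg (g x)).eq_or_lt with h0 | hpos
  · rw [← h0, mul_zero]
    exact dirichletForm_self_nonneg G g
  · obtain ⟨c, hc1, hc2, hc3⟩ := hscale g hg hpos
    have h1 : dirichletForm G f f ≤ dirichletForm G (c • g) (c • g) := by
      by_cases h : dirichletForm G (c • g) (c • g) ≤ R
      · exact hmin ⟨hc1, hc2, h⟩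
      · exact hf3.trans (not_le.1 h).le
    rw [dirichletForm_smul_right, dirichletForm_comm G (c • g) g, dirichletForm_smul_right] at h1
    calc dirichletForm G f f * ∑ x ∈ B, g x ^ 2
        ≤ (c * (c * dirichletForm G g g)) * ∑ x ∈ B, g x ^ 2 := by gcongr
      _ = (c ^ 2 * ∑ x ∈ B, g x ^ 2) * dirichletForm G g g := by ring
      _ = dirichletForm G g g := by rw [hc3, one_mul]

/-- A minimiser of the Rayleigh quotient solves the Steklov problem. The eigenvalue is half of
`dirichletForm G f f`, as the latter counts each edge twice. -/
theorem mem_steklovEigenspace_of_minimizer {G : SimpleGraph V} {B : Finset V} (hB : B.Nonempty)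
    {f : V → ℝ} (hf : ∑ x ∈ B, f x = 0) (hf1 : ∑ x ∈ B, f x ^ 2 = 1)
    (hmin : ∀ g : V → ℝ, ∑ x ∈ B, g x = 0 →
      dirichletForm G f f * ∑ x ∈ B, g x ^ 2 ≤ dirichletForm G g g) :
    f ∈ steklovEigenspace G B (dirichletForm G f f / 2) := by
  classical
  set m := dirichletForm G f f with hm
  -- First variation along a direction of mean zero.
  have hvar : ∀ g : V → ℝ, ∑ x ∈ B, g x = 0 → dirichletForm G f g = m * ∑ x ∈ B, f x * g x := by
    intro g hg
    have hquad : ∀ t : ℝ, 0 ≤ (dirichletForm G g g - m * ∑ x ∈ B, g x ^ 2) * (t * t) +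
        2 * (dirichletForm G f g - m * ∑ x ∈ B, f x * g x) * t + 0 := by
      intro t
      have h1 := hmin (f + t • g) (by
        simp only [Pi.add_apply, Pi.smul_apply, smul_eq_mul, Finset.sum_add_distrib,
          ← Finset.mul_sum, hf, hg]
        ring)
      have h2 : ∑ x ∈ B, (f + t • g) x ^ 2 =
          1 + 2 * t * ∑ x ∈ B, f x * g x + t ^ 2 * ∑ x ∈ B, g x ^ 2 := by
        rw [← hf1, Finset.mul_sum, Finset.mul_sum, ← Finset.sum_add_distrib,
          ← Finset.sum_add_distrib]
        refine Finset.sum_congr rfl fun x _ => ?_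
        simp only [Pi.add_apply, Pi.smul_apply, smul_eq_mul]
        ring
      have h3 : dirichletForm G (f + t • g) (f + t • g) =
          m + 2 * t * dirichletForm G f g + t ^ 2 * dirichletForm G g g := by
        rw [dirichletForm_add_right, dirichletForm_comm G (f + t • g) f,
          dirichletForm_comm G (f + t • g) (t • g), dirichletForm_add_right,
          dirichletForm_add_right, dirichletForm_smul_right, dirichletForm_smul_right,
          dirichletForm_comm G (t • g) f, dirichletForm_comm G (t • g) g,
          dirichletForm_smul_right, dirichletForm_smul_right]
        ring
      rw [h2, h3] at h1
      linarith
    have h := discrim_le_zero hquad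
    rw [discrim, mul_zero, sub_zero] at h
    have h0 := pow_eq_zero_iff two_ne_zero |>.1 (le_antisymm h (sq_nonneg _))
    linarith
  have hvar' : ∀ g : V → ℝ, dirichletForm G f g = m * ∑ x ∈ B, f x * g x := by
    intro g
    have hc : (B.card : ℝ) ≠ 0 := by exact_mod_cast hB.card_pos.ne'
    have h1 := hvar (g + fun _ => -((∑ x ∈ B, g x) / B.card)) (by
      simp only [Pi.add_apply, Finset.sum_add_distrib, Finset.sum_const, nsmul_eq_mul]
      field_simp
      ring)
    rw [dirichletForm_add_right, dirichletForm_const_right, add_zero] at h1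
    rw [h1]
    congr 1
    simp only [Pi.add_apply, mul_add, Finset.sum_add_distrib, ← Finset.sum_mul, hf]
    ring
  have hpt : ∀ x, graphLaplacian G f x = if x ∈ B then m / 2 * f x else 0 := by
    intro x
    have h1 := hvar' (Pi.single x 1)
    rw [dirichletForm_eq_sum_graphLaplacian] at h1
    simp only [Pi.single_apply, mul_ite, mul_one, mul_zero, Finset.sum_ite_eq',
      Finset.mem_univ, if_true] at h1
    split_ifs at h1 ⊢ <;> linarith
  exact ⟨fun x hx => by rw [hpt, if_neg hx], fun x hx => by rw [hpt, if_pos hx]⟩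

theorem const_mem_steklovEigenspace_zero (G : SimpleGraph V) (B : Finset V) (c : ℝ) :
    (fun _ => c) ∈ steklovEigenspace G B 0 :=
  ⟨fun x _ => by simp [graphLaplacian], fun x _ => by simp [graphLaplacian]⟩

theorem dirichletForm_of_mem_steklovEigenspace {G : SimpleGraph V} {B : Finset V} {μ : ℝ}
    {f : V → ℝ} (hf : f ∈ steklovEigenspace G B μ) (g : V → ℝ) :
    dirichletForm G f g = 2 * μ * ∑ x ∈ B, f x * g x := by
  have h : ∑ x ∈ B, graphLaplacian G f x * g x = ∑ x, graphLaplacian G f x * g x :=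
    Finset.sum_subset (Finset.subset_univ B) fun x _ hx => by rw [hf.1 x hx, zero_mul]
  rw [dirichletForm_eq_sum_graphLaplacian, ← h, Finset.mul_sum, Finset.mul_sum]
  refine Finset.sum_congr rfl fun x hx => ?_
  rw [hf.2 x hx]
  ring

/-- The second Steklov eigenvalue is the minimum of the Rayleigh quotient over the functions of
mean zero on the boundary. -/
theorem steklovEigenvalue_two_eq {G : SimpleGraph V} (hG : G.Connected) {B : Finset V}
    (hB : 2 ≤ B.card) {f : V → ℝ} (hf : ∑ x ∈ B, f x = 0) (hf1 : ∑ x ∈ B, f x ^ 2 = 1)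
    (hmin : ∀ g : V → ℝ, ∑ x ∈ B, g x = 0 →
      dirichletForm G f f * ∑ x ∈ B, g x ^ 2 ≤ dirichletForm G g g) :
    steklovEigenvalue G B 2 = dirichletForm G f f / 2 := by
  have hne : B.Nonempty := Finset.card_pos.1 (by omega)
  obtain ⟨b, hb⟩ := hne
  have hmem := mem_steklovEigenspace_of_minimizer ⟨b, hb⟩ hf hf1 hmin
  have hnn : 0 ≤ dirichletForm G f f / 2 := div_nonneg (dirichletForm_self_nonneg G f) zero_le_two
  refine IsLeast.csInf_eq ⟨?_, fun t ht => ?_⟩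
  · have hind : LinearIndependent ℝ ![fun _ : V => (1 : ℝ), f] := by
      rw [LinearIndependent.pair_iff]
      intro s t hst
      have hpt : ∀ x, s + t * f x = 0 := fun x => by simpa using congrFun hst x
      have h1 : ∑ x ∈ B, (s + t * f x) = 0 := Finset.sum_eq_zero fun x _ => hpt x
      rw [Finset.sum_add_distrib, ← Finset.mul_sum, hf, mul_zero, add_zero, Finset.sum_const,
        nsmul_eq_mul] at h1
      have hs : s = 0 := by
        rcases mul_eq_zero.1 h1 with h | h
        · have : B.card = 0 := by exact_mod_cast h
          omega
        · exact h
      refine ⟨hs, ?_⟩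
      have h2 : ∑ x ∈ B, t * f x * f x = 0 := Finset.sum_eq_zero fun x _ => by
        have := hpt x
        rw [hs, zero_add] at this
        rw [this, zero_mul]
      have h3 : t * ∑ x ∈ B, f x ^ 2 = 0 := by
        rw [Finset.mul_sum, ← h2]
        exact Finset.sum_congr rfl fun x _ => by ring
      rwa [hf1, mul_one] at h3
    have hspan : Submodule.span ℝ (Set.range ![fun _ : V => (1 : ℝ), f]) ≤
        ⨆ (μ : ℝ) (_ : μ ≤ dirichletForm G f f / 2), steklovEigenspace G B μ := by
      rw [Submodule.span_le]
      rintro _ ⟨i, rfl⟩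
      fin_cases i
      · exact Submodule.mem_iSup_of_mem 0 (Submodule.mem_iSup_of_mem hnn
          (const_mem_steklovEigenspace_zero G B 1))
      · exact Submodule.mem_iSup_of_mem _ (Submodule.mem_iSup_of_mem le_rfl hmem)
    have h := Submodule.finrank_mono hspan
    rwa [finrank_span_eq_card hind, Fintype.card_fin] at h
  · by_contra! hlt
    -- Below the minimum of the Rayleigh quotient, all eigenfunctions are constant.
    have hle : (⨆ (μ : ℝ) (_ : μ ≤ t), steklovEigenspace G B μ : Submodule ℝ (V → ℝ)) ≤
        Submodule.span ℝ {fun _ : V => (1 : ℝ)} := by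
      refine iSup₂_le fun μ hμ φ hφ => ?_
      have h1 := dirichletForm_of_mem_steklovEigenspace hφ φ
      have h2 := dirichletForm_of_mem_steklovEigenspace hφ fun _ => (1 : ℝ)
      rw [dirichletForm_const_right] at h2
      simp only [mul_one, ← sq] at h1 h2
      have hsq : 0 ≤ ∑ x ∈ B, φ x ^ 2 := Finset.sum_nonneg fun x _ => sq_nonneg _
      have h0 : dirichletForm G φ φ = 0 := by
        by_cases hμ0 : μ = 0
        · rw [h1, hμ0, mul_zero, zero_mul]
        · have hmean : ∑ x ∈ B, φ x = 0 := by
            rcases mul_eq_zero.1 h2.symm with h | h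
            · exact absurd h (mul_ne_zero two_ne_zero hμ0)
            · exact h
          have h3 := hmin φ hmean
          have h4 : ∑ x ∈ B, φ x ^ 2 = 0 := by
            by_contra hne
            have hpos := lt_of_le_of_ne hsq (Ne.symm hne)
            rw [h1] at h3
            have := le_of_mul_le_mul_right h3 hpos
            linarith
          rw [h1, h4, mul_zero]
      have hconst := eq_of_dirichletForm_self_eq_zero hG h0
      refine Submodule.mem_span_singleton.2 ⟨φ b, ?_⟩
      funext x
      simp [hconst b x]
    have h := Submodule.finrank_mono hle
    have h' := finrank_span_singleton (K := ℝ) (v := fun _ : V => (1 : ℝ))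
      (fun h => one_ne_zero (congrFun h b))
    rw [h'] at h
    have : 2 ≤ Module.finrank ℝ
      (⨆ (μ : ℝ) (_ : μ ≤ t), steklovEigenspace G B μ : Submodule ℝ (V → ℝ)) := ht
    omega

theorem exists_dirichletForm_eq_steklovEigenvalue_two {G : SimpleGraph V} (hG : G.Connected)
    {B : Finset V} (hB : 2 ≤ B.card) :
    ∃ f : V → ℝ, ∑ x ∈ B, f x = 0 ∧ ∑ x ∈ B, f x ^ 2 = 1 ∧
      dirichletForm G f f = 2 * steklovEigenvalue G B 2 := by
  obtain ⟨f, hf, hf1, hmin⟩ := exists_forall_mul_le_dirichletForm hG hB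
  exact ⟨f, hf, hf1, by rw [steklovEigenvalue_two_eq hG hB hf hf1 hmin]; ring⟩

theorem steklovEigenvalue_two_mul_le {G : SimpleGraph V} (hG : G.Connected)
    {B : Finset V} (hB : 2 ≤ B.card) {g : V → ℝ} (hg : ∑ x ∈ B, g x = 0) :
    2 * steklovEigenvalue G B 2 * ∑ x ∈ B, g x ^ 2 ≤ dirichletForm G g g := by
  obtain ⟨f, hf, hf1, hmin⟩ := exists_forall_mul_le_dirichletForm hG hB
  have h := hmin g hg
  rw [steklovEigenvalue_two_eq hG hB hf hf1 hmin]
  linarith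

theorem steklovEigenvalue_two_nonneg {G : SimpleGraph V} (hG : G.Connected)
    {B : Finset V} (hB : 2 ≤ B.card) : 0 ≤ steklovEigenvalue G B 2 := by
  obtain ⟨f, -, -, h⟩ := exists_dirichletForm_eq_steklovEigenvalue_two hG hB
  have := dirichletForm_self_nonneg G f
  linarith

theorem dirichletForm_self_le_of_degree_le {G : SimpleGraph V} {D : ℕ}
    (hD : ∀ v, (G.neighborSet v).ncard ≤ D) {f φ : V → ℝ} (hφ : ∀ x, 0 ≤ φ x)
    (h : ∀ x y, G.Adj x y → (f x - f y) ^ 2 ≤ φ x + φ y) :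
    dirichletForm G f f ≤ 2 * D * ∑ x, φ x := by
  classical
  have hdeg : ∀ x, ∑ y, (if G.Adj x y then φ x else 0) ≤ D * φ x := by
    intro x
    rw [← Finset.sum_filter, Finset.sum_const, nsmul_eq_mul]
    refine mul_le_mul_of_nonneg_right ?_ (hφ x)
    refine Nat.cast_le.2 (le_trans (le_of_eq ?_) (hD x))
    rw [← Set.ncard_coe_finset]
    congr 1
    ext y
    simp
  have h2 : dirichletForm G f f ≤ ∑ x, ∑ y, ((if G.Adj x y then φ x else 0) +
      if G.Adj x y then φ y else 0) := by
    refine Finset.sum_le_sum fun x _ => Finset.sum_le_sum fun y _ => ?_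
    split_ifs with hxy
    · rw [← sq]
      exact h x y hxy
    · simp
  have h3 : ∑ x, ∑ y, (if G.Adj x y then φ y else 0) =
      ∑ x, ∑ y, if G.Adj x y then φ x else 0 := by
    rw [Finset.sum_comm]
    simp only [G.adj_comm]
  have h4 : ∑ x, ∑ y, (if G.Adj x y then φ x else 0) ≤ D * ∑ x, φ x := by
    rw [Finset.mul_sum]
    exact Finset.sum_le_sum fun x _ => hdeg x
  simp only [Finset.sum_add_distrib, h3] at h2
  linarith

theorem steklovEigenvalue_two_le_of_degree_le {G : SimpleGraph V} (hG : G.Connected)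
    {B : Finset V} (hB : 2 ≤ B.card) {D : ℕ} (hD : ∀ v, (G.neighborSet v).ncard ≤ D) :
    steklovEigenvalue G B 2 ≤ 2 * D := by
  obtain ⟨f, hf, hf2, hf3⟩ := exists_sum_eq_zero_sum_sq_eq_two hB
  have h1 := steklovEigenvalue_two_mul_le hG hB hf
  have h2 := dirichletForm_self_le_of_degree_le hD (f := f) (φ := fun x => 2 * f x ^ 2)
    (fun x => by positivity) fun x y _ => by nlinarith [sq_nonneg (f x + f y)]
  rw [← Finset.mul_sum, hf3] at h2
  rw [hf2] at h1
  linarith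

end Variational

namespace TriangleComplex

/-! ### Ordered faces and their descendants under subdivision -/

/-- `{a, b, c}` is a face with three distinct vertices, listed in the order `T = (a, b, c)`. -/
def IsOrderedFace (K : TriangleComplex.{u}) (T : K.Vert × K.Vert × K.Vert) : Prop :=
  T.1 ≠ T.2.1 ∧ T.2.1 ≠ T.2.2 ∧ T.1 ≠ T.2.2 ∧ ({T.1, T.2.1, T.2.2} : Set K.Vert) ∈ K.faces

namespace IsOrderedFace

variable {K : TriangleComplex.{u}} {a b c : K.Vert}

theorem rotate (h : K.IsOrderedFace (a, b, c)) : K.IsOrderedFace (b, c, a) := by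
  obtain ⟨h1, h2, h3, h4⟩ := h
  refine ⟨h2, Ne.symm h3, Ne.symm h1, ?_⟩
  have : ({b, c, a} : Set K.Vert) = {a, b, c} := by
    ext x
    simp only [Set.mem_insert_iff, Set.mem_singleton_iff]
    tauto
  simpa only [this] using h4

theorem swap (h : K.IsOrderedFace (a, b, c)) : K.IsOrderedFace (a, c, b) := by
  obtain ⟨h1, h2, h3, h4⟩ := h
  exact ⟨h3, Ne.symm h2, h1, by simpa only [Set.pair_comm c b] using h4⟩

theorem adj (h : K.IsOrderedFace (a, b, c)) : K.graph.Adj a b :=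
  ⟨h.1, _, h.2.2.2, by simp, by simp⟩

end IsOrderedFace

open Classical in
/-- The midpoint of `a` and `b` in the hexagon-subdivision. Where `a` and `b` are not adjacent this
is a junk value, chosen to be symmetric in `a` and `b`. -/
noncomputable def midpoint (K : TriangleComplex.{u}) (a b : K.Vert) : K.hexSubdivision.Vert :=
  if h : K.graph.Adj a b then Sum.inr ⟨s(a, b), h⟩ else Sum.inl (Classical.choice ⟨a⟩)

/-- An old vertex, as a vertex of the hexagon-subdivision. -/
def oldVert (K : TriangleComplex.{u}) (a : K.Vert) : K.hexSubdivision.Vert :=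
  Sum.inl a

theorem oldVert_injective (K : TriangleComplex.{u}) : Function.Injective K.oldVert :=
  Sum.inl_injective

theorem midpoint_of_adj {K : TriangleComplex.{u}} {a b : K.Vert} (h : K.graph.Adj a b) :
    K.midpoint a b = Sum.inr ⟨s(a, b), h⟩ :=
  dif_pos h

theorem midpoint_comm (K : TriangleComplex.{u}) (a b : K.Vert) :
    K.midpoint a b = K.midpoint b a := by
  by_cases h : K.graph.Adj a b
  · rw [midpoint_of_adj h, midpoint_of_adj h.symm]
    congr 2
    exact Sym2.eq_swap
  · have h1 : K.midpoint a b = Sum.inl (Classical.choice ⟨a⟩) := dif_neg h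
    have h2 : K.midpoint b a = Sum.inl (Classical.choice ⟨a⟩) :=
      dif_neg (mt (K.graph.adj_comm b a).1 h)
    rw [h1, h2]

theorem midpoint_eq_midpoint_iff {K : TriangleComplex.{u}} {a b c d : K.Vert}
    (h : K.graph.Adj a b) (h' : K.graph.Adj c d) :
    K.midpoint a b = K.midpoint c d ↔ s(a, b) = s(c, d) := by
  rw [midpoint_of_adj h, midpoint_of_adj h']
  exact ⟨fun e => congrArg Subtype.val (Sum.inr_injective e), fun e => by congr 2⟩

theorem oldVert_ne_midpoint {K : TriangleComplex.{u}} {a b c : K.Vert} (h : K.graph.Adj b c) :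
    K.oldVert a ≠ K.midpoint b c := by
  rw [midpoint_of_adj h]
  exact Sum.inl_ne_inr

/-- The four triangles into which a triangle is divided. The vertices of each are listed so that its
sides correspond to the parallel sides of the given triangle. -/
noncomputable def child (K : TriangleComplex.{u}) (T : K.Vert × K.Vert × K.Vert) :
    Fin 4 → K.hexSubdivision.Vert × K.hexSubdivision.Vert × K.hexSubdivision.Vert :=
  ![(K.oldVert T.1, K.midpoint T.1 T.2.1, K.midpoint T.1 T.2.2),
    (K.midpoint T.1 T.2.1, K.oldVert T.2.1, K.midpoint T.2.1 T.2.2),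
    (K.midpoint T.1 T.2.2, K.midpoint T.2.1 T.2.2, K.oldVert T.2.2),
    (K.midpoint T.2.1 T.2.2, K.midpoint T.1 T.2.2, K.midpoint T.1 T.2.1)]

theorem child_inj {K : TriangleComplex.{u}} {T T' : K.Vert × K.Vert × K.Vert}
    (hT : K.IsOrderedFace T) (hT' : K.IsOrderedFace T') {i j : Fin 4}
    (h : K.child T i = K.child T' j) : T = T' ∧ i = j := by
  obtain ⟨a, b, c⟩ := T
  obtain ⟨a', b', c'⟩ := T'
  have hab := hT.adj
  have hac := hT.swap.adj
  have hbc := hT.rotate.adj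
  have hab' := hT'.adj
  have hac' := hT'.swap.adj
  have hbc' := hT'.rotate.adj
  have n1 := hab.ne
  have n2 := hac.ne
  have n3 := hbc.ne
  have e := @oldVert_ne_midpoint K
  have e1 := fun x => (e (a := x) hab)
  have e2 := fun x => (e (a := x) hac)
  have e3 := fun x => (e (a := x) hbc)
  have e1' := fun x => (e (a := x) hab')
  have e2' := fun x => (e (a := x) hac')
  have e3' := fun x => (e (a := x) hbc')
  have hold : ∀ x y, K.oldVert x = K.oldVert y ↔ x = y := fun x y => K.oldVert_injective.eq_iff
  -- The positions of the old vertices determine the index of the child.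
  fin_cases i <;> fin_cases j <;>
    simp only [child, Prod.mk.injEq, Matrix.cons_val, Fin.zero_eta, Fin.mk_one, Fin.reduceFinMk,
      e1', e2', e3', (e1 _).symm, (e2 _).symm, (e3 _).symm, hold,
      midpoint_eq_midpoint_iff, hab, hac, hbc, hab', hac', hbc',
      Sym2.eq_iff, false_and, and_false] at h
  all_goals
    refine ⟨?_, rfl⟩
    simp only [Prod.mk.injEq]
    grind

theorem isOrderedFace_midpoints {K : TriangleComplex.{u}} {a b c : K.Vert}
    (h : K.IsOrderedFace (a, b, c)) :
    K.hexSubdivision.IsOrderedFace (K.midpoint b c, K.midpoint a c, K.midpoint a b) := by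
  have hab := h.adj
  have hac := h.swap.adj
  have hbc := h.rotate.adj
  have n1 := hab.ne
  have n2 := hac.ne
  have n3 := hbc.ne
  refine ⟨?_, ?_, ?_, a, b, c, hab, hbc, hac, h.2.2.2, Or.inr ?_⟩
  · rw [ne_eq, midpoint_eq_midpoint_iff hbc hac, Sym2.eq_iff]; grind
  · rw [ne_eq, midpoint_eq_midpoint_iff hac hab, Sym2.eq_iff]; grind
  · rw [ne_eq, midpoint_eq_midpoint_iff hbc hab, Sym2.eq_iff]; grind
  · have hperm : ∀ x y z : K.hexSubdivision.Vert,
        ({x, y, z} : Set K.hexSubdivision.Vert) = {z, x, y} := by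
      intro x y z
      rw [Set.pair_comm y z, Set.insert_comm]
    simp only [midpoint_of_adj hab, midpoint_of_adj hac, midpoint_of_adj hbc]
    exact hperm _ _ _

theorem isOrderedFace_corner {K : TriangleComplex.{u}} {a b c : K.Vert}
    (h : K.IsOrderedFace (a, b, c)) :
    K.hexSubdivision.IsOrderedFace (K.oldVert a, K.midpoint a b, K.midpoint a c) := by
  have hab := h.adj
  have hac := h.swap.adj
  have hbc := h.rotate.adj
  have n1 := hab.ne
  have n2 := hac.ne
  have n3 := hbc.ne
  refine ⟨oldVert_ne_midpoint hab, ?_, oldVert_ne_midpoint hac, a, b, c, hab, hbc, hac, h.2.2.2,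
    Or.inl ?_⟩
  · rw [ne_eq, midpoint_eq_midpoint_iff hab hac, Sym2.eq_iff]; grind
  · simp only [midpoint_of_adj hab, midpoint_of_adj hac]
    rfl

theorem IsOrderedFace.child {K : TriangleComplex.{u}} {T : K.Vert × K.Vert × K.Vert}
    (hT : K.IsOrderedFace T) (i : Fin 4) : K.hexSubdivision.IsOrderedFace (K.child T i) := by
  obtain ⟨a, b, c⟩ := T
  have h0 := isOrderedFace_corner hT
  have h1 := (isOrderedFace_corner hT.rotate).rotate.rotate
  have h2 := (isOrderedFace_corner hT.rotate.rotate).rotate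
  have h3 := isOrderedFace_midpoints hT
  rw [K.midpoint_comm b a] at h1
  rw [K.midpoint_comm c a, K.midpoint_comm c b] at h2
  fin_cases i <;> assumption

open Classical in
/-- The ordered triangles obtained from those in `S` by `k` subdivisions. -/
noncomputable def descendants : (K : TriangleComplex.{u}) → (k : ℕ) →
    Finset (K.Vert × K.Vert × K.Vert) →
    Finset ((K.refine k).Vert × (K.refine k).Vert × (K.refine k).Vert)
  | _, 0, S => S
  | K, k + 1, S => descendants K.hexSubdivision k (S.biUnion fun T => Finset.univ.image (K.child T))

/-- The sum of `h` over the `4 ^ k` triangles into which `T` is divided by `k` subdivisions. -/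
noncomputable def descendantSum : (K : TriangleComplex.{u}) → (k : ℕ) →
    ((K.refine k).Vert × (K.refine k).Vert × (K.refine k).Vert → ℝ) →
    K.Vert × K.Vert × K.Vert → ℝ
  | _, 0, h, T => h T
  | K, k + 1, h, T => ∑ i, descendantSum K.hexSubdivision k h (K.child T i)

theorem isOrderedFace_of_mem_descendants {K : TriangleComplex.{u}} {k : ℕ}
    {S : Finset (K.Vert × K.Vert × K.Vert)} (hS : ∀ T ∈ S, K.IsOrderedFace T) :
    ∀ τ ∈ K.descendants k S, (K.refine k).IsOrderedFace τ := by
  induction k generalizing K with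
  | zero => exact hS
  | succ k ih =>
    classical
    refine ih fun T hT => ?_
    obtain ⟨T', hT', h⟩ := Finset.mem_biUnion.1 hT
    obtain ⟨i, -, rfl⟩ := Finset.mem_image.1 h
    exact (hS T' hT').child i

theorem sum_descendantSum {K : TriangleComplex.{u}} {k : ℕ}
    {S : Finset (K.Vert × K.Vert × K.Vert)} (hS : ∀ T ∈ S, K.IsOrderedFace T)
    (h : (K.refine k).Vert × (K.refine k).Vert × (K.refine k).Vert → ℝ) :
    ∑ T ∈ S, K.descendantSum k h T = ∑ τ ∈ K.descendants k S, h τ := by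
  induction k generalizing K with
  | zero => rfl
  | succ k ih =>
    classical
    refine Eq.trans ?_ (ih (K := K.hexSubdivision) (fun T hT => ?_) h)
    · rw [Finset.sum_biUnion]
      · refine Finset.sum_congr rfl fun T hT => ?_
        rw [Finset.sum_image fun i _ j _ hij => (child_inj (hS T hT) (hS T hT) hij).2]
        rfl
      · intro T hT T' hT' hne
        refine Finset.disjoint_left.2 fun τ h1 h2 => ?_
        obtain ⟨i, -, rfl⟩ := Finset.mem_image.1 h1
        obtain ⟨j, -, hj⟩ := Finset.mem_image.1 h2
        exact hne (child_inj (hS T hT) (hS T' hT') hj.symm).1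
    · obtain ⟨T', hT', h⟩ := Finset.mem_biUnion.1 hT
      obtain ⟨i, -, rfl⟩ := Finset.mem_image.1 h
      exact (hS T' hT').child i

theorem descendantSum_mono (K : TriangleComplex.{u}) {k : ℕ}
    {h h' : (K.refine k).Vert × (K.refine k).Vert × (K.refine k).Vert → ℝ} (hh : ∀ τ, h τ ≤ h' τ)
    (T : K.Vert × K.Vert × K.Vert) : K.descendantSum k h T ≤ K.descendantSum k h' T := by
  induction k generalizing K with
  | zero => exact hh T
  | succ k ih => exact Finset.sum_le_sum fun i _ => ih K.hexSubdivision hh _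

theorem descendantSum_mul_add_const (K : TriangleComplex.{u}) {k : ℕ}
    (h : (K.refine k).Vert × (K.refine k).Vert × (K.refine k).Vert → ℝ) (c d : ℝ)
    (T : K.Vert × K.Vert × K.Vert) :
    K.descendantSum k (fun τ => c * h τ + d) T = c * K.descendantSum k h T + 4 ^ k * d := by
  induction k generalizing K with
  | zero => simp [descendantSum]
  | succ k ih =>
    have e : K.descendantSum (k + 1) (fun τ => c * h τ + d) T =
      ∑ i, K.hexSubdivision.descendantSum k (fun τ => c * h τ + d) (K.child T i) := rfl
    rw [e, Finset.sum_congr rfl fun i _ => ih K.hexSubdivision h (K.child T i),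
      Finset.sum_add_distrib, ← Finset.mul_sum]
    simp only [Finset.sum_const, Finset.card_univ, Fintype.card_fin, nsmul_eq_mul]
    change c * K.descendantSum (k + 1) h T + _ = _
    push_cast
    ring

theorem card_descendants {K : TriangleComplex.{u}} {k : ℕ}
    {S : Finset (K.Vert × K.Vert × K.Vert)} (hS : ∀ T ∈ S, K.IsOrderedFace T) :
    ((K.descendants k S).card : ℝ) = 4 ^ k * S.card := by
  have h1 := sum_descendantSum (k := k) hS fun _ => 1
  have h2 := fun T => K.descendantSum_mul_add_const (k := k) (fun _ => 0) 0 1 T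
  simp only [zero_mul, zero_add, mul_one] at h2
  simp only [h2, Finset.sum_const, nsmul_eq_mul, mul_one] at h1
  rw [← h1, mul_comm]

open Classical in
/-- The first vertices of the descendants include the first vertices of the original triangles. -/
theorem card_image_fst_le_card_image_fst_descendants (K : TriangleComplex.{u}) (k : ℕ)
    (S : Finset (K.Vert × K.Vert × K.Vert)) :
    (S.image Prod.fst).card ≤ ((K.descendants k S).image Prod.fst).card := by
  induction k generalizing K with
  | zero => exact le_rfl
  | succ k ih =>
    refine le_trans ?_ (ih K.hexSubdivision _)
    rw [← Finset.card_image_of_injective _ K.oldVert_injective, Finset.image_image]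
    refine Finset.card_le_card fun v hv => ?_
    obtain ⟨T, hT, rfl⟩ := Finset.mem_image.1 hv
    exact Finset.mem_image.2 ⟨K.child T 0, Finset.mem_biUnion.2
      ⟨T, hT, Finset.mem_image_of_mem _ (Finset.mem_univ _)⟩, rfl⟩

/-! ### Local energy and edge averages -/

/-- The energy of `f` in the triangle `T`. -/
def faceEnergy {V : Type u} (f : V → ℝ) (T : V × V × V) : ℝ :=
  (f T.1 - f T.2.1) ^ 2 + (f T.2.1 - f T.2.2) ^ 2 + (f T.2.2 - f T.1) ^ 2

theorem faceEnergy_nonneg {V : Type u} (f : V → ℝ) (T : V × V × V) : 0 ≤ faceEnergy f T := by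
  unfold faceEnergy
  positivity

/-- The energy that a function on the `k`-th subdivision has inside the triangle `T`. -/
noncomputable def localEnergy (K : TriangleComplex.{u}) (k : ℕ) (f : (K.refine k).Vert → ℝ)
    (T : K.Vert × K.Vert × K.Vert) : ℝ :=
  K.descendantSum k (faceEnergy f) T

theorem localEnergy_succ (K : TriangleComplex.{u}) (k : ℕ) (f : (K.refine (k + 1)).Vert → ℝ)
    (T : K.Vert × K.Vert × K.Vert) :
    K.localEnergy (k + 1) f T = K.hexSubdivision.localEnergy k f (K.child T 0) +
      K.hexSubdivision.localEnergy k f (K.child T 1) +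
      K.hexSubdivision.localEnergy k f (K.child T 2) +
      K.hexSubdivision.localEnergy k f (K.child T 3) :=
  Fin.sum_univ_four fun i => K.hexSubdivision.localEnergy k f (K.child T i)

theorem localEnergy_nonneg (K : TriangleComplex.{u}) (k : ℕ) (f : (K.refine k).Vert → ℝ)
    (T : K.Vert × K.Vert × K.Vert) : 0 ≤ K.localEnergy k f T := by
  have h := K.descendantSum_mono (k := k) (faceEnergy_nonneg f) T
  have h' := K.descendantSum_mul_add_const (k := k) (fun _ => 0) 0 0 T
  simp only [zero_mul, zero_add, mul_zero] at h'
  rwa [h'] at h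

theorem localEnergy_rotate (K : TriangleComplex.{u}) (k : ℕ) (f : (K.refine k).Vert → ℝ)
    (a b c : K.Vert) : K.localEnergy k f (b, c, a) = K.localEnergy k f (a, b, c) := by
  induction k generalizing K with
  | zero => simp only [localEnergy, descendantSum, faceEnergy]; ring
  | succ k ih =>
    simp only [localEnergy_succ, child, Matrix.cons_val]
    have h0 := ih K.hexSubdivision f (K.oldVert a) (K.midpoint a b) (K.midpoint a c)
    have h0' := ih K.hexSubdivision f (K.midpoint a b) (K.midpoint a c) (K.oldVert a)
    have h1 := ih K.hexSubdivision f (K.midpoint a b) (K.oldVert b) (K.midpoint b c)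
    have h2 := ih K.hexSubdivision f (K.midpoint a c) (K.midpoint b c) (K.oldVert c)
    have h3 := ih K.hexSubdivision f (K.midpoint b c) (K.midpoint a c) (K.midpoint a b)
    rw [K.midpoint_comm b a, K.midpoint_comm c a, h1, h2, h3]
    linarith

theorem localEnergy_swap (K : TriangleComplex.{u}) (k : ℕ) (f : (K.refine k).Vert → ℝ)
    (a b c : K.Vert) : K.localEnergy k f (a, c, b) = K.localEnergy k f (a, b, c) := by
  induction k generalizing K with
  | zero => simp only [localEnergy, descendantSum, faceEnergy]; ring
  | succ k ih =>
    simp only [localEnergy_succ, child, Matrix.cons_val]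
    have h0 := ih K.hexSubdivision f (K.oldVert a) (K.midpoint a b) (K.midpoint a c)
    have h1 := ih K.hexSubdivision f (K.midpoint a b) (K.oldVert b) (K.midpoint b c)
    have h2 := ih K.hexSubdivision f (K.midpoint a c) (K.midpoint b c) (K.oldVert c)
    have h3 := ih K.hexSubdivision f (K.midpoint b c) (K.midpoint a c) (K.midpoint a b)
    rw [K.midpoint_comm c b]
    linarith

/-- The average of `f` over the edge `ab` after `k` subdivisions, each of the `2 ^ k` small edges
into which `ab` is divided contributing the mean of its two end values. -/
noncomputable def edgeAverage : (K : TriangleComplex.{u}) → (k : ℕ) → ((K.refine k).Vert → ℝ) →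
    K.Vert → K.Vert → ℝ
  | _, 0, f, a, b => (f a + f b) / 2
  | K, k + 1, f, a, b =>
    (edgeAverage K.hexSubdivision k f (K.oldVert a) (K.midpoint a b) +
      edgeAverage K.hexSubdivision k f (K.midpoint a b) (K.oldVert b)) / 2

theorem edgeAverage_succ (K : TriangleComplex.{u}) (k : ℕ) (f : (K.refine (k + 1)).Vert → ℝ)
    (a b : K.Vert) : K.edgeAverage (k + 1) f a b =
    (K.hexSubdivision.edgeAverage k f (K.oldVert a) (K.midpoint a b) +
      K.hexSubdivision.edgeAverage k f (K.midpoint a b) (K.oldVert b)) / 2 :=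
  rfl

theorem edgeAverage_comm (K : TriangleComplex.{u}) (k : ℕ) (f : (K.refine k).Vert → ℝ)
    (a b : K.Vert) : K.edgeAverage k f a b = K.edgeAverage k f b a := by
  induction k generalizing K with
  | zero => simp only [edgeAverage]; ring
  | succ k ih =>
    rw [edgeAverage_succ, edgeAverage_succ, ih K.hexSubdivision f (K.oldVert a) (K.midpoint a b),
      ih K.hexSubdivision f (K.midpoint a b) (K.oldVert b), K.midpoint_comm b a]
    ring

/-- The averages over two sides of a triangle differ by at most the square root of the energy in the
triangle. The constant does not deteriorate under subdivision: the difference is half of a sum of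
the four corresponding differences in the smaller triangles. -/
theorem sq_edgeAverage_sub_le (K : TriangleComplex.{u}) (k : ℕ) (f : (K.refine k).Vert → ℝ)
    (a b c : K.Vert) :
    (K.edgeAverage k f a b - K.edgeAverage k f a c) ^ 2 ≤ K.localEnergy k f (a, b, c) := by
  induction k generalizing K with
  | zero =>
    simp only [localEnergy, descendantSum, faceEnergy, edgeAverage]
    nlinarith [sq_nonneg (f a - f b), sq_nonneg (f b - f c), sq_nonneg (f c - f a)]
  | succ k ih =>
    rw [edgeAverage_succ, edgeAverage_succ, localEnergy_succ]
    simp only [child, Matrix.cons_val]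
    have h0 := ih K.hexSubdivision f (K.oldVert a) (K.midpoint a b) (K.midpoint a c)
    have h1 := ih K.hexSubdivision f (K.midpoint a b) (K.oldVert b) (K.midpoint b c)
    have h2 := ih K.hexSubdivision f (K.midpoint a c) (K.midpoint b c) (K.oldVert c)
    have h3 := ih K.hexSubdivision f (K.midpoint b c) (K.midpoint a c) (K.midpoint a b)
    rw [K.hexSubdivision.edgeAverage_comm k f (K.midpoint b c) (K.midpoint a c),
      K.hexSubdivision.edgeAverage_comm k f (K.midpoint b c) (K.midpoint a b)] at h3
    have hcs : ∀ p q r s : ℝ, ((p + q + r - s) / 2) ^ 2 ≤ p ^ 2 + q ^ 2 + r ^ 2 + s ^ 2 := by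
      intro p q r s
      nlinarith [sq_nonneg (p - q), sq_nonneg (p - r), sq_nonneg (p + s), sq_nonneg (q - r),
        sq_nonneg (q + s), sq_nonneg (r + s)]
    refine le_trans (le_trans (le_of_eq ?_) (hcs _ _ _ _))
      (add_le_add (add_le_add (add_le_add h0 h1) h2) h3)
    ring

theorem sq_edgeAverage_sub_le_snd (K : TriangleComplex.{u}) (k : ℕ) (f : (K.refine k).Vert → ℝ)
    (a b c : K.Vert) :
    (K.edgeAverage k f a b - K.edgeAverage k f b c) ^ 2 ≤ K.localEnergy k f (a, b, c) := by
  rw [edgeAverage_comm K k f a b, ← localEnergy_rotate, ← localEnergy_swap]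
  exact K.sq_edgeAverage_sub_le k f b a c

theorem sq_edgeAverage_sub_le_thd (K : TriangleComplex.{u}) (k : ℕ) (f : (K.refine k).Vert → ℝ)
    (a b c : K.Vert) :
    (K.edgeAverage k f a c - K.edgeAverage k f c b) ^ 2 ≤ K.localEnergy k f (a, b, c) := by
  rw [← localEnergy_swap]
  exact K.sq_edgeAverage_sub_le_snd k f a c b

/-- A Poincaré inequality in a triangle with `4 ^ k` parts. Passing to the four smaller triangles
halves the constant and adds the cost of comparing their edge averages, so that the constant stays
bounded. -/
theorem descendantSum_sq_sub_edgeAverage_le (K : TriangleComplex.{u}) (k : ℕ)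
    (f : (K.refine k).Vert → ℝ) (T : K.Vert × K.Vert × K.Vert) :
    K.descendantSum k (fun τ => (f τ.1 - K.edgeAverage k f T.1 T.2.1) ^ 2) T ≤
      16 * 4 ^ k * K.localEnergy k f T := by
  induction k generalizing K with
  | zero =>
    obtain ⟨a, b, c⟩ := T
    simp only [localEnergy, descendantSum, faceEnergy, edgeAverage]
    nlinarith [sq_nonneg (f a - f b), sq_nonneg (f b - f c), sq_nonneg (f c - f a)]
  | succ k ih =>
    set γ := K.edgeAverage (k + 1) f T.1 T.2.1 with hγ
    have hchild : ∀ i, K.hexSubdivision.descendantSum k (fun τ => (f τ.1 - γ) ^ 2) (K.child T i) ≤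
        2 * (16 * 4 ^ k * K.hexSubdivision.localEnergy k f (K.child T i)) + 4 ^ k *
        (2 * (K.hexSubdivision.edgeAverage k f (K.child T i).1 (K.child T i).2.1 - γ) ^ 2) := by
      intro i
      set γ' := K.hexSubdivision.edgeAverage k f (K.child T i).1 (K.child T i).2.1 with hγ'
      refine (K.hexSubdivision.descendantSum_mono
        (h' := fun τ => 2 * (f τ.1 - γ') ^ 2 + 2 * (γ' - γ) ^ 2) (fun τ => ?_) _).trans ?_
      · nlinarith [sq_nonneg ((f τ.1 - γ') - (γ' - γ))]
      · rw [K.hexSubdivision.descendantSum_mul_add_const (fun τ => (f τ.1 - γ') ^ 2)]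
        have := ih K.hexSubdivision f (K.child T i)
        linarith
    have e : K.descendantSum (k + 1) (fun τ => (f τ.1 - γ) ^ 2) T =
      ∑ i, K.hexSubdivision.descendantSum k (fun τ => (f τ.1 - γ) ^ 2) (K.child T i) := rfl
    rw [e, Fin.sum_univ_four]
    have hE := K.localEnergy_succ k f T
    obtain ⟨a, b, c⟩ := T
    rw [edgeAverage_succ] at hγ
    have c0 := hchild 0
    have c1 := hchild 1
    have c2 := hchild 2
    have c3 := hchild 3
    -- Every two of the edges used in the four triangles are joined by a chain of pairs of sides.
    have x0 := K.hexSubdivision.sq_edgeAverage_sub_le_snd k f (K.oldVert a) (K.midpoint a b)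
      (K.midpoint a c)
    have x1 := K.hexSubdivision.sq_edgeAverage_sub_le k f (K.midpoint a b) (K.oldVert b)
      (K.midpoint b c)
    have x3 := K.hexSubdivision.sq_edgeAverage_sub_le_thd k f (K.midpoint b c) (K.midpoint a c)
      (K.midpoint a b)
    have x4 := K.hexSubdivision.sq_edgeAverage_sub_le k f (K.midpoint b c) (K.midpoint a c)
      (K.midpoint a b)
    have y2 := K.hexSubdivision.localEnergy_nonneg k f
      (K.midpoint a c, K.midpoint b c, K.oldVert c)
    rw [K.hexSubdivision.edgeAverage_comm k f (K.midpoint b c) (K.midpoint a b)] at x3 x4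
    simp only [child, Matrix.cons_val] at c0 c1 c2 c3 hE hγ ⊢
    rw [K.hexSubdivision.edgeAverage_comm k f (K.midpoint a c) (K.midpoint b c)] at c2
    generalize K.hexSubdivision.edgeAverage k f (K.oldVert a) (K.midpoint a b) = p at *
    generalize K.hexSubdivision.edgeAverage k f (K.midpoint a b) (K.oldVert b) = q at *
    generalize K.hexSubdivision.edgeAverage k f (K.midpoint a b) (K.midpoint a c) = r at *
    generalize K.hexSubdivision.edgeAverage k f (K.midpoint a b) (K.midpoint b c) = s at *
    generalize K.hexSubdivision.edgeAverage k f (K.midpoint b c) (K.midpoint a c) = t at *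
    have h1 : 2 * (p - γ) ^ 2 + 2 * (q - γ) ^ 2 + 2 * (t - γ) ^ 2 + 2 * (t - γ) ^ 2 ≤
        32 * K.localEnergy (k + 1) f (a, b, c) := by
      have e1 : p - γ = ((p - r) - (s - r) - (q - s)) / 2 := by rw [hγ]; ring
      have e2 : q - γ = (-(p - r) + (s - r) + (q - s)) / 2 := by rw [hγ]; ring
      have e3 : t - γ = (t - s) + ((s - r) - (p - r) - (q - s)) / 2 := by rw [hγ]; ring
      rw [e1, e2, e3]
      generalize p - r = u at *
      generalize s - r = v at *
      generalize q - s = w at *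
      generalize t - s = z at *
      have i1 : ∀ x y z : ℝ, (x + y + z) ^ 2 ≤ 3 * (x ^ 2 + y ^ 2 + z ^ 2) := fun x y z => by
        nlinarith [sq_nonneg (x - y), sq_nonneg (y - z), sq_nonneg (x - z)]
      have i2 : ∀ x y : ℝ, (x + y) ^ 2 ≤ 2 * (x ^ 2 + y ^ 2) := fun x y => by
        nlinarith [sq_nonneg (x - y)]
      have j1 := i1 u (-v) (-w)
      have j2 := i1 (-u) v w
      have j3 := i2 z ((v - u - w) / 2)
      have j4 := i1 v (-u) (-w)
      linarith [sq_nonneg u, sq_nonneg v, sq_nonneg w, sq_nonneg z]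
    have h2 := mul_le_mul_of_nonneg_left h1 (pow_nonneg (zero_le_four (α := ℝ)) k)
    rw [pow_succ]
    rw [hE] at h2 ⊢
    linarith

/-! ### Bounded geometry, and its preservation under subdivision -/

/-- A connected complex of triangles, with at most two triangles at each edge and at most `M` edges
at each vertex. The bounds are stated with finite sets covering the third vertices and the
neighbours. -/
structure HasBoundedGeometry (K : TriangleComplex.{u}) (M : ℕ) : Prop where
  exists_third : ∀ {a b}, K.graph.Adj a b → ∃ c, K.IsOrderedFace (a, b, c)
  third_bound : ∀ {a b}, K.graph.Adj a b →
    ∃ s : Finset K.Vert, s.card ≤ 2 ∧ ∀ c, K.IsOrderedFace (a, b, c) → c ∈ s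
  degree_bound : ∀ a, ∃ s : Finset K.Vert, s.card ≤ M ∧ ∀ b, K.graph.Adj a b → b ∈ s
  connected : K.graph.Connected

theorem exists_isOrderedFace_of_adj {K : TriangleComplex.{u}}
    (hK : ∀ t ∈ K.faces, ∃ a b c, t = {a, b, c} ∧ K.IsOrderedFace (a, b, c)) {a b : K.Vert}
    (h : K.graph.Adj a b) : ∃ c, K.IsOrderedFace (a, b, c) := by
  obtain ⟨hne, t, ht, ha, hb⟩ := h
  obtain ⟨x, y, z, rfl, hf⟩ := hK t ht
  simp only [Set.mem_insert_iff, Set.mem_singleton_iff] at ha hb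
  rcases ha with rfl | rfl | rfl <;> rcases hb with rfl | rfl | rfl
  · exact absurd rfl hne
  · exact ⟨_, hf⟩
  · exact ⟨_, hf.swap⟩
  · exact ⟨_, hf.rotate.swap⟩
  · exact absurd rfl hne
  · exact ⟨_, hf.rotate⟩
  · exact ⟨_, hf.rotate.rotate⟩
  · exact ⟨_, hf.rotate.rotate.swap⟩
  · exact absurd rfl hne

theorem IsFullTriangulation.hasBoundedGeometry {K : TriangleComplex.{u}}
    (hK : K.IsFullTriangulation) {D M : ℕ} (hDM : D ≤ M)
    (hD : ∀ v : K.Vert, (K.graph.neighborSet v).ncard ≤ D) : K.HasBoundedGeometry M where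
  exists_third := by
    refine exists_isOrderedFace_of_adj fun t ht => ?_
    obtain ⟨a, b, c, hab, hac, hbc, rfl⟩ := Set.ncard_eq_three.1 (hK.triangle t ht)
    exact ⟨a, b, c, rfl, hab, hbc, hac, ht⟩
  third_bound := by
    classical
    intro a b hab
    refine ⟨Finset.univ.filter fun c => K.IsOrderedFace (a, b, c), ?_,
      fun c hc => by simpa using hc⟩
    rw [← Set.ncard_coe_finset, ← hK.two_faces a b hab]
    refine Set.ncard_le_ncard_of_injOn (fun c => {a, b, c}) (fun c hc => ?_) (fun c hc d hd h => ?_)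
      (Set.toFinite _)
    · have hc' : K.IsOrderedFace (a, b, c) := by simpa using hc
      exact ⟨hc'.2.2.2, by simp, by simp⟩
    · have hc' : K.IsOrderedFace (a, b, c) := by simpa using hc
      have hmem : c ∈ ({a, b, d} : Set K.Vert) := by
        rw [← show ({a, b, c} : Set K.Vert) = {a, b, d} from h]
        simp
      rcases hmem with rfl | rfl | h
      · exact absurd rfl hc'.2.2.1
      · exact absurd rfl hc'.2.1
      · exact h
  degree_bound := fun a => by
    classical
    refine ⟨(K.graph.neighborSet a).toFinset, ?_, fun b hb => by simpa using hb⟩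
    rw [← Set.ncard_eq_toFinset_card']
    exact (hD a).trans hDM
  connected := hK.connected

/-- Three distinct elements of a three-element set are its elements, in some order. -/
theorem eq_perm_of_insert_eq {α : Type*} {x y z p q r : α} (hxy : x ≠ y) (hyz : y ≠ z)
    (hxz : x ≠ z) (h : ({x, y, z} : Set α) = {p, q, r}) :
    (x, y, z) = (p, q, r) ∨ (x, y, z) = (p, r, q) ∨ (x, y, z) = (q, p, r) ∨
      (x, y, z) = (q, r, p) ∨ (x, y, z) = (r, p, q) ∨ (x, y, z) = (r, q, p) := by
  have hx : x ∈ ({p, q, r} : Set α) := by rw [← h]; simp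
  have hy : y ∈ ({p, q, r} : Set α) := by rw [← h]; simp
  have hz : z ∈ ({p, q, r} : Set α) := by rw [← h]; simp
  simp only [Set.mem_insert_iff, Set.mem_singleton_iff] at hx hy hz
  simp only [Prod.mk.injEq]
  grind

/-- The ordered faces of the hexagon-subdivision: a corner, with its old vertex in any of the three
positions, or a central triangle. -/
theorem IsOrderedFace.exists_of_hexSubdivision {K : TriangleComplex.{u}}
    {x y z : K.hexSubdivision.Vert} (h : K.hexSubdivision.IsOrderedFace (x, y, z)) :
    ∃ a b c, K.IsOrderedFace (a, b, c) ∧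
      ((x, y, z) = (K.oldVert a, K.midpoint a b, K.midpoint a c) ∨
        (x, y, z) = (K.midpoint a b, K.oldVert a, K.midpoint a c) ∨
        (x, y, z) = (K.midpoint a b, K.midpoint a c, K.oldVert a) ∨
        (x, y, z) = (K.midpoint a b, K.midpoint a c, K.midpoint b c)) := by
  obtain ⟨h1, h2, h3, a, b, c, hab, hbc, hac, hf, h⟩ := h
  have hF : K.IsOrderedFace (a, b, c) := ⟨hab.ne, hbc.ne, hac.ne, hf⟩
  rw [← midpoint_of_adj hab, ← midpoint_of_adj hac, ← midpoint_of_adj hbc] at h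
  rcases h with h | h
  · rcases eq_perm_of_insert_eq h1 h2 h3 h with e | e | e | e | e | e
    · exact ⟨a, b, c, hF, Or.inl e⟩
    · exact ⟨a, c, b, hF.swap, Or.inl e⟩
    · exact ⟨a, b, c, hF, Or.inr (Or.inl e)⟩
    · exact ⟨a, b, c, hF, Or.inr (Or.inr (Or.inl e))⟩
    · exact ⟨a, c, b, hF.swap, Or.inr (Or.inl e)⟩
    · exact ⟨a, c, b, hF.swap, Or.inr (Or.inr (Or.inl e))⟩
  · have s1 := K.midpoint_comm a b
    have s2 := K.midpoint_comm a c
    have s3 := K.midpoint_comm b c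
    rcases eq_perm_of_insert_eq h1 h2 h3 h with e | e | e | e | e | e
    · exact ⟨b, a, c, hF.rotate.swap, Or.inr (Or.inr (Or.inr (by rw [e, s1])))⟩
    · exact ⟨a, b, c, hF, Or.inr (Or.inr (Or.inr e))⟩
    · exact ⟨b, c, a, hF.rotate, Or.inr (Or.inr (Or.inr (by rw [e, s1, s2])))⟩
    · exact ⟨c, b, a, hF.rotate.rotate.swap, Or.inr (Or.inr (Or.inr (by rw [e, s1, s2, s3])))⟩
    · exact ⟨a, c, b, hF.swap, Or.inr (Or.inr (Or.inr (by rw [e, s3])))⟩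
    · exact ⟨c, a, b, hF.rotate.rotate, Or.inr (Or.inr (Or.inr (by rw [e, s2, s3])))⟩

theorem hexSubdivision_exists_third {K : TriangleComplex.{u}} {x y : K.hexSubdivision.Vert}
    (h : K.hexSubdivision.graph.Adj x y) : ∃ z, K.hexSubdivision.IsOrderedFace (x, y, z) := by
  refine exists_isOrderedFace_of_adj (fun t ht => ?_) h
  obtain ⟨a, b, c, hab, hbc, hac, hf, h⟩ := ht
  have hF : K.IsOrderedFace (a, b, c) := ⟨hab.ne, hbc.ne, hac.ne, hf⟩
  rw [← midpoint_of_adj hab, ← midpoint_of_adj hac, ← midpoint_of_adj hbc] at h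
  rcases h with h | h
  · exact ⟨_, _, _, h, isOrderedFace_corner hF⟩
  · have h' := isOrderedFace_midpoints hF.rotate.rotate
    rw [K.midpoint_comm c b, K.midpoint_comm c a] at h'
    exact ⟨_, _, _, h, h'⟩

theorem HasBoundedGeometry.hexSubdivision_third_bound {K : TriangleComplex.{u}} {M : ℕ}
    (hK : K.HasBoundedGeometry M) {x y : K.hexSubdivision.Vert}
    (h : K.hexSubdivision.graph.Adj x y) : ∃ s : Finset K.hexSubdivision.Vert,
      s.card ≤ 2 ∧ ∀ z, K.hexSubdivision.IsOrderedFace (x, y, z) → z ∈ s := by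
  classical
  have hold : ∀ x y, K.oldVert x = K.oldVert y ↔ x = y := fun x y => K.oldVert_injective.eq_iff
  -- Half-edges: the third vertices come from those of the divided edge.
  have hcorner : ∀ a b, K.graph.Adj a b → ∃ s : Finset K.hexSubdivision.Vert, s.card ≤ 2 ∧
      ∀ z, K.hexSubdivision.IsOrderedFace (K.oldVert a, K.midpoint a b, z) → z ∈ s := by
    intro a b hab
    obtain ⟨s, hs, hs'⟩ := hK.third_bound hab
    refine ⟨s.image (K.midpoint a), Finset.card_image_le.trans hs, fun z hz => ?_⟩
    obtain ⟨a', b', c', hF, e⟩ := hz.exists_of_hexSubdivision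
    simp only [Prod.mk.injEq, hold, oldVert_ne_midpoint hF.adj, false_and, or_false] at e
    obtain ⟨rfl, e, rfl⟩ := e
    rw [midpoint_eq_midpoint_iff hab hF.adj, Sym2.congr_right] at e
    subst e
    exact Finset.mem_image_of_mem _ (hs' _ hF)
  -- Edges joining two midpoints: one triangle is a corner and the other one is central.
  have hcentral : ∀ a b c, K.IsOrderedFace (a, b, c) → ∃ s : Finset K.hexSubdivision.Vert,
      s.card ≤ 2 ∧
      ∀ z, K.hexSubdivision.IsOrderedFace (K.midpoint a b, K.midpoint a c, z) → z ∈ s := by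
    intro a b c hF
    refine ⟨{K.oldVert a, K.midpoint b c}, Finset.card_le_two, fun z hz => ?_⟩
    obtain ⟨a', b', c', hF', e⟩ := hz.exists_of_hexSubdivision
    have n := hF.rotate.adj.ne
    have n' := hF'.rotate.adj.ne
    have n1 := hF.adj.ne
    have n2 := hF.swap.adj.ne
    simp only [Prod.mk.injEq, (oldVert_ne_midpoint hF.adj).symm,
      (oldVert_ne_midpoint hF.swap.adj).symm, false_and, and_false, false_or,
      midpoint_eq_midpoint_iff hF.adj hF'.adj,
      midpoint_eq_midpoint_iff hF.swap.adj hF'.swap.adj, Sym2.eq_iff] at e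
    have key : a = a' ∧ b = b' ∧ c = c' := by grind
    obtain ⟨rfl, rfl, rfl⟩ := key
    rw [Finset.mem_insert, Finset.mem_singleton]
    exact e.imp (fun h => h.2.2) fun h => h.2.2
  obtain ⟨z, hz⟩ := hexSubdivision_exists_third h
  obtain ⟨a, b, c, hF, e⟩ := hz.exists_of_hexSubdivision
  simp only [Prod.mk.injEq] at e
  rcases e with ⟨rfl, rfl, -⟩ | ⟨rfl, rfl, -⟩ | ⟨rfl, rfl, -⟩ | ⟨rfl, rfl, -⟩
  · exact hcorner a b hF.adj
  · obtain ⟨s, hs, hs'⟩ := hcorner a b hF.adj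
    exact ⟨s, hs, fun z hz => hs' z hz.rotate.swap⟩
  · exact hcentral a b c hF
  · exact hcentral a b c hF

theorem HasBoundedGeometry.hexSubdivision_degree_bound {K : TriangleComplex.{u}} {M : ℕ}
    (hK : K.HasBoundedGeometry M) (hM : 6 ≤ M) (x : K.hexSubdivision.Vert) :
    ∃ s : Finset K.hexSubdivision.Vert,
      s.card ≤ M ∧ ∀ y, K.hexSubdivision.graph.Adj x y → y ∈ s := by
  classical
  have hold : ∀ x y, K.oldVert x = K.oldVert y ↔ x = y := fun x y => K.oldVert_injective.eq_iff
  rcases x with a | ⟨e, he⟩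
  · obtain ⟨s, hs, hs'⟩ := hK.degree_bound a
    refine ⟨s.image (K.midpoint a), Finset.card_image_le.trans hs, fun y hy => ?_⟩
    obtain ⟨z, hz⟩ := hexSubdivision_exists_third hy
    change K.hexSubdivision.IsOrderedFace (K.oldVert a, y, z) at hz
    obtain ⟨a', b', c', hF, e⟩ := hz.exists_of_hexSubdivision
    simp only [Prod.mk.injEq, hold, oldVert_ne_midpoint hF.adj, false_and, or_false] at e
    obtain ⟨rfl, rfl, -⟩ := e
    exact Finset.mem_image_of_mem _ (hs' _ hF.adj)
  · induction e using Sym2.ind with | _ a b => ?_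
    have hab : K.graph.Adj a b := he
    obtain ⟨s, hs, hs'⟩ := hK.third_bound hab
    -- The six neighbours of a midpoint: the two ends of the edge, and two further midpoints for
    -- each of the two triangles at the edge.
    refine ⟨{K.oldVert a, K.oldVert b} ∪ (s.image (K.midpoint a) ∪ s.image (K.midpoint b)),
      ?_, fun y hy => ?_⟩
    · have h1 := Finset.card_union_le {K.oldVert a, K.oldVert b}
        (s.image (K.midpoint a) ∪ s.image (K.midpoint b))
      have h2 := Finset.card_union_le (s.image (K.midpoint a)) (s.image (K.midpoint b))
      have h3 : (s.image (K.midpoint a)).card ≤ s.card := Finset.card_image_le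
      have h4 : (s.image (K.midpoint b)).card ≤ s.card := Finset.card_image_le
      have h5 : ({K.oldVert a, K.oldVert b} : Finset _).card ≤ 2 := Finset.card_le_two
      omega
    · obtain ⟨z, hz⟩ := hexSubdivision_exists_third hy
      have hz' : K.hexSubdivision.IsOrderedFace (K.midpoint a b, y, z) := by
        rw [midpoint_of_adj hab]
        exact hz
      obtain ⟨a', b', c', hF, e⟩ := hz'.exists_of_hexSubdivision
      simp only [Prod.mk.injEq, (oldVert_ne_midpoint hab).symm, false_and, false_or,
        midpoint_eq_midpoint_iff hab hF.adj] at e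
      simp only [Finset.mem_union, Finset.mem_insert, Finset.mem_singleton]
      have hends : s(a, b) = s(a', b') := by tauto
      have hy' : y = K.oldVert a' ∨ y = K.midpoint a' c' := by tauto
      rcases Sym2.eq_iff.1 hends with ⟨rfl, rfl⟩ | ⟨rfl, rfl⟩
      · rcases hy' with rfl | rfl
        · exact Or.inl (Or.inl rfl)
        · exact Or.inr (Or.inl (Finset.mem_image_of_mem _ (hs' _ hF)))
      · rcases hy' with rfl | rfl
        · exact Or.inl (Or.inr rfl)
        · exact Or.inr (Or.inr (Finset.mem_image_of_mem _ (hs' _ hF.rotate.swap)))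

theorem HasBoundedGeometry.hexSubdivision_connected {K : TriangleComplex.{u}} {M : ℕ}
    (hK : K.HasBoundedGeometry M) : K.hexSubdivision.graph.Connected := by
  have hmid : ∀ a b, K.graph.Adj a b →
      K.hexSubdivision.graph.Adj (K.oldVert a) (K.midpoint a b) := by
    intro a b hab
    obtain ⟨c, hc⟩ := hK.exists_third hab
    exact (isOrderedFace_corner hc).adj
  have hold : ∀ a b, K.hexSubdivision.graph.Reachable (K.oldVert a) (K.oldVert b) := by
    intro a b
    obtain ⟨p⟩ := hK.connected.preconnected a b
    induction p with
    | nil => exact SimpleGraph.Reachable.rfl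
    | @cons a b c hab p ih =>
      have h1 := hmid b a hab.symm
      rw [K.midpoint_comm b a] at h1
      exact (hmid a b hab).reachable.trans (h1.symm.reachable.trans ih)
  obtain ⟨r⟩ := hK.connected.nonempty
  have hroot : ∀ x, K.hexSubdivision.graph.Reachable x (K.oldVert r) := by
    rintro (a | ⟨e, he⟩)
    · exact hold a r
    · induction e using Sym2.ind with | _ a b => ?_
      have hab : K.graph.Adj a b := he
      have h1 := (hmid a b hab).symm.reachable
      rw [midpoint_of_adj hab] at h1
      exact h1.trans (hold a r)
  have : Nonempty K.hexSubdivision.Vert := ⟨K.oldVert r⟩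
  exact ⟨fun x y => (hroot x).trans (hroot y).symm⟩

theorem HasBoundedGeometry.refine {K : TriangleComplex.{u}} {M : ℕ}
    (hK : K.HasBoundedGeometry M) (hM : 6 ≤ M) (k : ℕ) : (K.refine k).HasBoundedGeometry M := by
  induction k generalizing K with
  | zero => exact hK
  | succ k ih =>
    exact ih (K := K.hexSubdivision)
      { exists_third := hexSubdivision_exists_third
        third_bound := hK.hexSubdivision_third_bound
        degree_bound := hK.hexSubdivision_degree_bound hM
        connected := hK.hexSubdivision_connected }

/-! ### Sums over ordered faces -/

open Classical in
/-- All ordered faces of `K`. -/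
noncomputable def orderedFaces (K : TriangleComplex.{u}) : Finset (K.Vert × K.Vert × K.Vert) :=
  Finset.univ.filter K.IsOrderedFace

theorem mem_orderedFaces {K : TriangleComplex.{u}} {T : K.Vert × K.Vert × K.Vert} :
    T ∈ K.orderedFaces ↔ K.IsOrderedFace T := by
  simp [orderedFaces]

theorem HasBoundedGeometry.sum_faceEnergy_le {K : TriangleComplex.{u}} {M : ℕ}
    (hK : K.HasBoundedGeometry M) (f : K.Vert → ℝ) :
    ∑ T ∈ K.orderedFaces, faceEnergy f T ≤ 6 * dirichletForm K.graph f f := by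
  classical
  have hside : ∑ a, ∑ b, ∑ c, (if K.IsOrderedFace (a, b, c) then (f a - f b) ^ 2 else 0) ≤
      2 * dirichletForm K.graph f f := by
    rw [dirichletForm, Finset.mul_sum]
    refine Finset.sum_le_sum fun a _ => ?_
    rw [Finset.mul_sum]
    refine Finset.sum_le_sum fun b _ => ?_
    by_cases hab : K.graph.Adj a b
    · obtain ⟨s, hs, hs'⟩ := hK.third_bound hab
      rw [if_pos hab, ← Finset.sum_filter, Finset.sum_const, nsmul_eq_mul, ← sq]
      gcongr
      have h1 : (Finset.univ.filter fun c => K.IsOrderedFace (a, b, c)) ⊆ s := fun c hc =>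
        hs' c (by simpa using hc)
      exact_mod_cast (Finset.card_le_card h1).trans hs
    · rw [if_neg hab, mul_zero]
      exact (Finset.sum_eq_zero fun c _ => if_neg fun h => hab h.adj).le
  have hrot : ∀ a b c, K.IsOrderedFace (b, c, a) ↔ K.IsOrderedFace (a, b, c) := fun a b c =>
    ⟨fun h => h.rotate.rotate, fun h => h.rotate⟩
  have hcyc : ∀ F : K.Vert → K.Vert → K.Vert → ℝ, ∑ a, ∑ b, ∑ c, F b c a =
      ∑ a, ∑ b, ∑ c, F a b c := by
    intro F
    rw [Finset.sum_comm]
    exact Finset.sum_congr rfl fun b _ => Finset.sum_comm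
  have h2 := hcyc fun a b c => if K.IsOrderedFace (a, b, c) then (f a - f b) ^ 2 else 0
  have h3 := hcyc fun a b c => if K.IsOrderedFace (b, c, a) then (f b - f c) ^ 2 else 0
  simp only [hrot] at h2 h3
  have h4 : ∑ T ∈ K.orderedFaces, faceEnergy f T =
      ∑ a, ∑ b, ∑ c, ((if K.IsOrderedFace (a, b, c) then (f a - f b) ^ 2 else 0) +
        (if K.IsOrderedFace (a, b, c) then (f b - f c) ^ 2 else 0) +
        if K.IsOrderedFace (a, b, c) then (f c - f a) ^ 2 else 0) := by
    rw [orderedFaces, Finset.sum_filter]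
    simp only [Fintype.sum_prod_type]
    refine Finset.sum_congr rfl fun a _ => Finset.sum_congr rfl fun b _ =>
      Finset.sum_congr rfl fun c _ => ?_
    split_ifs <;> simp [faceEnergy]
  rw [h4]
  simp only [Finset.sum_add_distrib]
  linarith

theorem HasBoundedGeometry.sum_localEnergy_le {K : TriangleComplex.{u}} {M : ℕ}
    (hK : K.HasBoundedGeometry M) (hM : 6 ≤ M) (k : ℕ) (f : (K.refine k).Vert → ℝ) :
    ∑ T ∈ K.orderedFaces, K.localEnergy k f T ≤ 6 * dirichletForm (K.refine k).graph f f := by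
  have hS : ∀ T ∈ K.orderedFaces, K.IsOrderedFace T := fun T => mem_orderedFaces.1
  refine le_trans ?_ ((hK.refine hM k).sum_faceEnergy_le f)
  refine (sum_descendantSum hS _).le.trans ?_
  exact Finset.sum_le_sum_of_subset_of_nonneg
    (fun τ hτ => mem_orderedFaces.2 (isOrderedFace_of_mem_descendants hS τ hτ))
    fun τ _ _ => faceEnergy_nonneg f τ

open Classical in
theorem HasBoundedGeometry.card_le_mul_card_image_fst {K : TriangleComplex.{u}} {M : ℕ}
    (hK : K.HasBoundedGeometry M) {S : Finset (K.Vert × K.Vert × K.Vert)}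
    (hS : ∀ T ∈ S, K.IsOrderedFace T) : S.card ≤ M * 2 * (S.image Prod.fst).card := by
  refine Finset.card_le_mul_card_image S (M * 2) fun a _ => ?_
  obtain ⟨s, hs, hs'⟩ := hK.degree_bound a
  have hsub : S.filter (fun T => T.1 = a) ⊆ (s.filter (K.graph.Adj a)).biUnion fun b =>
      (Finset.univ.filter fun c => K.IsOrderedFace (a, b, c)).image fun c => (a, b, c) := by
    rintro ⟨a', b, c⟩ hT
    rw [Finset.mem_filter] at hT
    obtain ⟨hT, rfl⟩ := hT
    have hF := hS _ hT
    simp only [Finset.mem_biUnion, Finset.mem_filter, Finset.mem_image, Finset.mem_univ, true_and]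
    exact ⟨b, ⟨hs' b hF.adj, hF.adj⟩, c, hF, rfl⟩
  refine (Finset.card_le_card hsub).trans ((Finset.card_biUnion_le_card_mul _ _ 2 ?_).trans ?_)
  · intro b hb
    obtain ⟨t, ht, ht'⟩ := hK.third_bound (Finset.mem_filter.1 hb).2
    refine Finset.card_image_le.trans ((Finset.card_le_card fun c hc => ?_).trans ht)
    exact ht' c (by simpa using hc)
  · gcongr
    exact (Finset.card_le_card (Finset.filter_subset _ _)).trans hs

/-! ### Transplanting functions to the original graph -/

open Classical in
/-- The energy of `f` in the triangles at the vertex `v`, each counted in both orders that start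
with `v`. -/
noncomputable def vertexEnergy (K : TriangleComplex.{u}) (k : ℕ) (f : (K.refine k).Vert → ℝ)
    (v : K.Vert) : ℝ :=
  ∑ T ∈ K.orderedFaces with T.1 = v, K.localEnergy k f T

theorem vertexEnergy_nonneg (K : TriangleComplex.{u}) (k : ℕ) (f : (K.refine k).Vert → ℝ)
    (v : K.Vert) : 0 ≤ K.vertexEnergy k f v :=
  Finset.sum_nonneg fun T _ => K.localEnergy_nonneg k f T

theorem sum_vertexEnergy (K : TriangleComplex.{u}) (k : ℕ) (f : (K.refine k).Vert → ℝ) :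
    ∑ v, K.vertexEnergy k f v = ∑ T ∈ K.orderedFaces, K.localEnergy k f T := by
  classical
  exact Finset.sum_fiberwise _ _ _

/-- The averages over any two edges at a vertex are comparable: consecutive edges around the vertex
are sides of a common triangle, and at most `D` steps lead from one edge to the other. -/
theorem IsFullTriangulation.sq_edgeAverage_sub_le {K : TriangleComplex.{u}}
    (hK : K.IsFullTriangulation) {D : ℕ} (hD : ∀ v : K.Vert, (K.graph.neighborSet v).ncard ≤ D)
    (k : ℕ) (f : (K.refine k).Vert → ℝ) {v a b : K.Vert} (ha : K.graph.Adj v a)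
    (hb : K.graph.Adj v b) :
    (K.edgeAverage k f v a - K.edgeAverage k f v b) ^ 2 ≤ D ^ 2 * K.vertexEnergy k f v := by
  classical
  have hstep : ∀ x y : {w // K.graph.Adj v w}, (K.link v).Adj x y →
      |K.edgeAverage k f v x - K.edgeAverage k f v y| ≤ √(K.vertexEnergy k f v) := by
    intro x y hxy
    refine Real.abs_le_sqrt ((K.sq_edgeAverage_sub_le k f v x y).trans ?_)
    refine Finset.single_le_sum (f := K.localEnergy k f)
      (fun T _ => K.localEnergy_nonneg k f T) ?_
    rw [Finset.mem_filter, mem_orderedFaces]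
    exact ⟨⟨x.2.ne, fun h => hxy.1 (Subtype.ext h), y.2.ne, hxy.2⟩, rfl⟩
  have h1 := abs_sub_le_card_mul_of_connected (F := fun w => K.edgeAverage k f v w.1)
    (hK.link_connected v) (Real.sqrt_nonneg _) hstep ⟨a, ha⟩ ⟨b, hb⟩
  have hcard : Fintype.card {w // K.graph.Adj v w} ≤ D := by
    rw [← Nat.card_eq_fintype_card]
    exact hD v
  have h2 : |K.edgeAverage k f v a - K.edgeAverage k f v b| ≤ D * √(K.vertexEnergy k f v) := by
    refine h1.trans ?_
    gcongr
  rw [← sq_abs]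
  refine (pow_le_pow_left₀ (abs_nonneg _) h2 2).trans_eq ?_
  rw [mul_pow, Real.sq_sqrt (K.vertexEnergy_nonneg k f v)]

/-- Choosing an edge at every vertex, with other end `n v`, turns a function on the refined graph
into a function on the original graph, at a bounded cost in energy. -/
theorem IsFullTriangulation.dirichletForm_edgeAverage_le {K : TriangleComplex.{u}}
    (hK : K.IsFullTriangulation) {D : ℕ} (hD : ∀ v : K.Vert, (K.graph.neighborSet v).ncard ≤ D)
    (k : ℕ) (f : (K.refine k).Vert → ℝ) {n : K.Vert → K.Vert} (hn : ∀ v, K.graph.Adj v (n v)) :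
    dirichletForm K.graph (fun v => K.edgeAverage k f v (n v))
      (fun v => K.edgeAverage k f v (n v)) ≤
      24 * D ^ 3 * dirichletForm (K.refine k).graph f f := by
  have h1 := dirichletForm_self_le_of_degree_le hD (f := fun v => K.edgeAverage k f v (n v))
    (φ := fun v => 2 * (D ^ 2 * K.vertexEnergy k f v))
    (fun v => mul_nonneg zero_le_two (mul_nonneg (sq_nonneg _) (K.vertexEnergy_nonneg k f v)))
    fun v w hvw => by
      have h1 := hK.sq_edgeAverage_sub_le hD k f (hn v) hvw
      have h2 := hK.sq_edgeAverage_sub_le hD k f (hn w) hvw.symm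
      rw [K.edgeAverage_comm k f w v] at h2
      nlinarith [sq_nonneg ((K.edgeAverage k f v (n v) - K.edgeAverage k f v w) +
        (K.edgeAverage k f w (n w) - K.edgeAverage k f v w))]
  have hM : 6 ≤ D + 6 := Nat.le_add_left 6 D
  have h2 := (hK.hasBoundedGeometry (Nat.le_add_right D 6) hD).sum_localEnergy_le hM k f
  rw [← Finset.mul_sum, ← Finset.mul_sum, sum_vertexEnergy] at h1
  refine h1.trans ?_
  calc 2 * (D : ℝ) * (2 * (D ^ 2 * ∑ T ∈ K.orderedFaces, K.localEnergy k f T))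
      = 4 * D ^ 3 * ∑ T ∈ K.orderedFaces, K.localEnergy k f T := by ring
    _ ≤ 4 * D ^ 3 * (6 * dirichletForm (K.refine k).graph f f) := by gcongr
    _ = _ := by ring

/-- On the first vertices of the small triangles, `f` is close to its averages over the chosen
edges. -/
theorem sum_sq_sub_le_of_image_fst_descendants {K : TriangleComplex.{u}} (k : ℕ)
    (f : (K.refine k).Vert → ℝ) (m : ℝ) {S : Finset (K.Vert × K.Vert × K.Vert)}
    (hS : ∀ T ∈ S, K.IsOrderedFace T) {B : Finset (K.refine k).Vert}
    (hB : ∀ x ∈ B, ∃ τ ∈ K.descendants k S, τ.1 = x) :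
    ∑ x ∈ B, (f x - m) ^ 2 ≤ 4 ^ k * (32 * ∑ T ∈ S, K.localEnergy k f T +
      2 * ∑ T ∈ S, (K.edgeAverage k f T.1 T.2.1 - m) ^ 2) := by
  classical
  have h1 : ∑ x ∈ B, (f x - m) ^ 2 ≤ ∑ τ ∈ K.descendants k S, (f τ.1 - m) ^ 2 := by
    choose! F hF hF' using hB
    have hinj : Set.InjOn F B := fun x hx y hy h => by rw [← hF' x hx, ← hF' y hy, h]
    rw [Finset.sum_congr rfl fun x hx => show (f x - m) ^ 2 = (f (F x).1 - m) ^ 2 by rw [hF' x hx],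
      ← Finset.sum_image (f := fun τ => (f τ.1 - m) ^ 2) hinj]
    refine Finset.sum_le_sum_of_subset_of_nonneg (fun τ hτ => ?_) fun τ _ _ => sq_nonneg _
    obtain ⟨x, hx, rfl⟩ := Finset.mem_image.1 hτ
    exact hF x hx
  refine h1.trans ?_
  rw [← sum_descendantSum hS fun τ => (f τ.1 - m) ^ 2, Finset.mul_sum, Finset.mul_sum,
    ← Finset.sum_add_distrib, Finset.mul_sum]
  refine Finset.sum_le_sum fun T _ => ?_
  set γ := K.edgeAverage k f T.1 T.2.1 with hγ
  have h2 := K.descendantSum_mono (k := k) (h := fun τ => (f τ.1 - m) ^ 2)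
    (h' := fun τ => 2 * (f τ.1 - γ) ^ 2 + 2 * (γ - m) ^ 2)
    (fun τ => by nlinarith [sq_nonneg ((f τ.1 - γ) - (γ - m))]) T
  rw [K.descendantSum_mul_add_const fun τ => (f τ.1 - γ) ^ 2] at h2
  have h3 := K.descendantSum_sq_sub_edgeAverage_le k f T
  linarith

/-- Comparison of the second eigenvalues, when the new boundary consists of the first vertices of
the small triangles into which one triangle at each old boundary vertex is divided. -/
theorem IsFullTriangulation.steklovEigenvalue_two_le {K : TriangleComplex.{u}}
    (hK : K.IsFullTriangulation) {D : ℕ} (hD : ∀ v : K.Vert, (K.graph.neighborSet v).ncard ≤ D)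
    {n p : K.Vert → K.Vert} (hnp : ∀ v, K.IsOrderedFace (v, n v, p v)) {B : Finset K.Vert}
    (hB : 2 ≤ B.card) (k : ℕ) {S : Finset (K.Vert × K.Vert × K.Vert)}
    (hS : ∀ T, T ∈ S ↔ ∃ v ∈ B, (v, n v, p v) = T) {Bk : Finset (K.refine k).Vert}
    (hBk : 2 ≤ Bk.card) (hBk' : ∀ x ∈ Bk, ∃ τ ∈ K.descendants k S, τ.1 = x) :
    steklovEigenvalue K.graph B 2 ≤
      4 ^ k * ((768 * D + 48 * D ^ 3) * steklovEigenvalue (K.refine k).graph Bk 2) := by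
  classical
  have hM : 6 ≤ D + 6 := Nat.le_add_left 6 D
  have hG := hK.hasBoundedGeometry (Nat.le_add_right D 6) hD
  have hconn := (hG.refine hM k).connected
  obtain ⟨f, hf0, hf1, hfE⟩ := exists_dirichletForm_eq_steklovEigenvalue_two hconn hBk
  set lam := steklovEigenvalue K.graph B 2 with hlam
  set lamk := steklovEigenvalue (K.refine k).graph Bk 2 with hlamk
  have hlam0 : 0 ≤ lam := steklovEigenvalue_two_nonneg hK.connected hB
  have hlamk0 : 0 ≤ lamk := steklovEigenvalue_two_nonneg hconn hBk
  have hlamD : lam ≤ 2 * D := steklovEigenvalue_two_le_of_degree_le hK.connected hB hD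
  have hface : ∀ T ∈ S, K.IsOrderedFace T := by
    intro T hT
    obtain ⟨v, -, rfl⟩ := (hS T).1 hT
    exact hnp v
  have hSB : S = B.image fun v => (v, n v, p v) := by
    ext T
    rw [hS, Finset.mem_image]
  let g : K.Vert → ℝ := fun v => K.edgeAverage k f v (n v)
  set m := (∑ v ∈ B, g v) / B.card with hm
  have hgm : ∑ v ∈ B, (g v - m) = 0 := by
    have hc : (B.card : ℝ) ≠ 0 := by
      have : B.card ≠ 0 := by omega
      exact_mod_cast this
    rw [Finset.sum_sub_distrib, Finset.sum_const, nsmul_eq_mul, hm, mul_div_cancel₀ _ hc, sub_self]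
  have h1 := steklovEigenvalue_two_mul_le hK.connected hB hgm
  rw [dirichletForm_sub_const K.graph g m, ← hlam] at h1
  have h2 := hK.dirichletForm_edgeAverage_le hD k f fun v => (hnp v).adj
  have h3 := sum_sq_sub_le_of_image_fst_descendants k f m hface hBk'
  have h4 : ∑ T ∈ S, (K.edgeAverage k f T.1 T.2.1 - m) ^ 2 = ∑ v ∈ B, (g v - m) ^ 2 := by
    rw [hSB, Finset.sum_image fun v _ w _ h => congrArg Prod.fst h]
  have h5 : ∑ T ∈ S, K.localEnergy k f T ≤ 12 * lamk := by
    refine le_trans ?_ ((hG.sum_localEnergy_le hM k f).trans (by rw [hfE]; linarith))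
    exact Finset.sum_le_sum_of_subset_of_nonneg (fun T hT => mem_orderedFaces.2 (hface T hT))
      fun T _ _ => K.localEnergy_nonneg k f T
  -- As `f` has mean zero on `Bk`, subtracting a constant does not decrease its norm there.
  have h6 : 1 ≤ ∑ x ∈ Bk, (f x - m) ^ 2 := by
    have e : ∑ x ∈ Bk, (f x - m) ^ 2 = 1 + Bk.card * m ^ 2 := by
      have e1 : ∀ x, (f x - m) ^ 2 = f x ^ 2 - 2 * m * f x + m ^ 2 := fun x => by ring
      simp only [e1, Finset.sum_add_distrib, Finset.sum_sub_distrib, ← Finset.mul_sum, hf0, hf1,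
        Finset.sum_const, nsmul_eq_mul]
      ring
    rw [e]
    have : 0 ≤ (Bk.card : ℝ) * m ^ 2 := by positivity
    linarith
  rw [h4] at h3
  rw [hfE] at h2
  have h7 : 2 * lam * ∑ v ∈ B, (g v - m) ^ 2 ≤ 24 * D ^ 3 * (2 * lamk) := h1.trans h2
  have h8 : lam * ∑ T ∈ S, K.localEnergy k f T ≤ 2 * D * (12 * lamk) :=
    mul_le_mul hlamD h5 (Finset.sum_nonneg fun T _ => K.localEnergy_nonneg k f T) (by positivity)
  calc lam = lam * 1 := (mul_one _).symm
    _ ≤ lam * (4 ^ k * (32 * ∑ T ∈ S, K.localEnergy k f T + 2 * ∑ v ∈ B, (g v - m) ^ 2)) :=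
        mul_le_mul_of_nonneg_left (h6.trans h3) hlam0
    _ = 4 ^ k * (32 * (lam * ∑ T ∈ S, K.localEnergy k f T) +
          2 * lam * ∑ v ∈ B, (g v - m) ^ 2) := by ring
    _ ≤ 4 ^ k * (32 * (2 * D * (12 * lamk)) + 24 * D ^ 3 * (2 * lamk)) := by gcongr
    _ = 4 ^ k * ((768 * D + 48 * D ^ 3) * lamk) := by ring

theorem IsFullTriangulation.exists_isOrderedFace {K : TriangleComplex.{u}}
    (hK : K.IsFullTriangulation) (v : K.Vert) : ∃ a b, K.IsOrderedFace (v, a, b) := by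
  obtain ⟨⟨a, ha⟩⟩ := (hK.link_connected v).nonempty
  exact ⟨a, (hK.hasBoundedGeometry (M := Fintype.card K.Vert) le_rfl fun v => by
    rw [← Nat.card_eq_fintype_card, ← Set.ncard_univ]
    exact Set.ncard_le_ncard (Set.subset_univ _) (Set.toFinite _)).exists_third ha⟩

end TriangleComplex

theorem mainTheorem4 (D : ℕ) :
    ∃ c C : ℝ, 0 < c ∧ 0 < C ∧
      ∀ K : TriangleComplex.{u}, K.IsFullTriangulation →
        (∀ v : K.Vert, (K.graph.neighborSet v).ncard ≤ D) →
        ∀ B : Finset K.Vert, 2 ≤ B.card →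
        ∀ k : ℕ, ∃ Bk : Finset (K.refine k).Vert,
          2 ≤ Bk.card ∧
          c * 4 ^ k * (B.card : ℝ) ≤ (Bk.card : ℝ) ∧
          (Bk.card : ℝ) ≤ C * 4 ^ k * (B.card : ℝ) ∧
          (B.card : ℝ) * steklovEigenvalue K.graph B 2 ≤
            C * ((Bk.card : ℝ) * steklovEigenvalue (K.refine k).graph Bk 2) := by
  classical
  -- At most `2 * (D + 6)` ordered triangles of a subdivision have a given first vertex.
  refine ⟨(2 * (D + 6))⁻¹, 1 + 2 * (D + 6) * (768 * D + 48 * D ^ 3), by positivity, by positivity,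
    fun K hK hD B hB k => ?_⟩
  choose n p hnp using hK.exists_isOrderedFace
  have hS : ∀ T ∈ B.image fun v => (v, n v, p v), K.IsOrderedFace T := by
    intro T hT
    obtain ⟨v, -, rfl⟩ := Finset.mem_image.1 hT
    exact hnp v
  have hfst : (B.image fun v => (v, n v, p v)).image Prod.fst = B := by
    rw [Finset.image_image]
    exact Finset.image_id
  have hcardS : (B.image fun v => (v, n v, p v)).card = B.card :=
    Finset.card_image_of_injective _ fun v w h => congrArg Prod.fst h
  have hdesc := TriangleComplex.card_descendants (k := k) hS
  rw [hcardS] at hdesc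
  have hG := (hK.hasBoundedGeometry (Nat.le_add_right D 6) hD).refine (Nat.le_add_left 6 D) k
  have hlow := hG.card_le_mul_card_image_fst (TriangleComplex.isOrderedFace_of_mem_descendants hS)
  have hB' := K.card_image_fst_le_card_image_fst_descendants k (B.image fun v => (v, n v, p v))
  rw [hfst] at hB'
  set Bk := (K.descendants k (B.image fun v => (v, n v, p v))).image Prod.fst with hBk
  have hBk2 : 2 ≤ Bk.card := hB.trans hB'
  have hlow' : 4 ^ k * (B.card : ℝ) ≤ 2 * (D + 6) * (Bk.card : ℝ) := by
    rw [← hdesc]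
    calc ((K.descendants k (B.image fun v => (v, n v, p v))).card : ℝ)
        ≤ (((D + 6) * 2 * Bk.card : ℕ) : ℝ) := Nat.cast_le.2 hlow
      _ = 2 * (D + 6) * (Bk.card : ℝ) := by push_cast; ring
  have hup : (Bk.card : ℝ) ≤ 4 ^ k * (B.card : ℝ) := by
    rw [← hdesc]
    exact Nat.cast_le.2 Finset.card_image_le
  refine ⟨Bk, hBk2, ?_, ?_, ?_⟩
  · rw [mul_assoc, inv_mul_le_iff₀ (by positivity)]
    exact hlow'
  · refine hup.trans ?_
    rw [mul_assoc]
    refine le_mul_of_one_le_left (by positivity) (le_add_of_nonneg_right (by positivity))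
  · have hlam := hK.steklovEigenvalue_two_le hD hnp hB k
      (S := B.image fun v => (v, n v, p v)) (fun T => Finset.mem_image) hBk2
      (fun x hx => Finset.mem_image.1 hx)
    have h0 := steklovEigenvalue_two_nonneg hG.connected hBk2
    calc (B.card : ℝ) * steklovEigenvalue K.graph B 2
        ≤ B.card * (4 ^ k * ((768 * D + 48 * D ^ 3) *
            steklovEigenvalue (K.refine k).graph Bk 2)) := by gcongr
      _ = 4 ^ k * B.card * ((768 * D + 48 * D ^ 3) *
            steklovEigenvalue (K.refine k).graph Bk 2) := by ring
      _ ≤ 2 * (D + 6) * Bk.card * ((768 * D + 48 * D ^ 3) *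
            steklovEigenvalue (K.refine k).graph Bk 2) := by gcongr
      _ = 2 * (D + 6) * (768 * D + 48 * D ^ 3) *
            (Bk.card * steklovEigenvalue (K.refine k).graph Bk 2) := by ring
      _ ≤ _ := by
          refine mul_le_mul_of_nonneg_right (le_add_of_nonneg_left zero_le_one) (by positivity)
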